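/- Let $G$ be an \'etale, Hausdorff, locally compact, second countable topological groupoid with unit space $G^{(0)}$, range and source maps $r,s$, and let $\Sigma$ be a twist over $G$, that is a central extension of topological groupoids $\mathbf T\times G^{(0)}\to\Sigma\to G$ (with $\mathbf T$ the circle group) exhibiting $\mathbf T\times G^{(0)}$ as a topological subgroupoid of $\Sigma$ and $G$ as the quotient $\Sigma/\mathbf T$; write $\sigma\mapsto\dot\sigma$ for the map $\Sigma\to G$. Let $C_c(G,\Sigma)$ be the space of continuous functions $f:\Sigma\to\mathbf C$ with $f(z\sigma)=f(\sigma)\overline z$ for all $z\in\mathbf T$, $\sigma\in\Sigma$, which vanish off the preimage of a compact subset of $G$. For $x\in G^{(0)}$ put $G_x=s^{-1}(x)$ and let $H_x$ be the Hilbert space of functions $\xi$ on the preimage of $G_x$ in $\Sigma$ with $\xi(z\sigma)=\xi(\sigma)\overline z$ and $\sum_{\dot\tau\in G_x}|\xi(\tau)|^2<\infty$. Let $\pi_x(f)\in B(H_x)$ be given by $\pi_x(f)\xi(\sigma)=\sum_{\dot\tau\in G_x}f(\sigma\tau^{-1})\xi(\tau)$, and let $A=C^*_{red}(G,\Sigma)$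 be the completion of $C_c(G,\Sigma)$ for the norm $\|f\|=\sup_x\|\pi_x(f)\|$, i.e. the C$^*$-algebra generated by the operators $\pi(f)=(\pi_x(f))_x$ in $\prod_xB(H_x)$. Every $a\in A$ is viewed as a function on $\Sigma$ by $a(\sigma)=(\pi_{x}(a)\epsilon_{x})(\sigma)$ with $x=s(\dot\sigma)$, where $\epsilon_x\in H_x$ is given by $\epsilon_x(\tau)=\overline z$ if $\tau=(z,x)$ with $z\in\mathbf T$ and $\epsilon_x(\tau)=0$ otherwise; this extends the identity on $C_c(G,\Sigma)$. The algebra $C_0(G^{(0)})$ is viewed as a sub-C$^*$-algebra of $A$, where $h\in C_0(G^{(0)})$ is identified with the element whose function is $\sigma\mapsto h(x)\overline z$ if $\sigma=(z,x)\in\mathbf T\times G^{(0)}$ and $0$ elsewhere. A conditional expectation of $A$ onto $C_0(G^{(0)})$ is a contractive positive linear map $Q:A\to C_0(G^{(0)})$ such that $Q(h)=h$, $Q(ha)=hQ(a)$ and $Q(ah)=Q(a)h$ for $h\in C_0(G^{(0)})$, $a\in A$. Then restriction to the unit space, $P(a)(x)=a(1,x)$, is a well defined linear map $P:A\to C_0(G^{(0)})$,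 and: 1. $P$ is a conditional expectation of $A$ onto $C_0(G^{(0)})$. 2. $P$ is faithful: $P(a^*a)=0$ implies $a=0$. 3. If $G$ is essentially principal, i.e. if the interior of $\{\gamma\in G: r(\gamma)=s(\gamma)\}$ is $G^{(0)}$, then $P$ is the unique conditional expectation of $A$ onto $C_0(G^{(0)})$. -/

import Mathlib

open scoped ENNReal ComplexConjugate ZeroAtInfty

noncomputable section

namespace TwistedGroupoid

universe u v

/-- A topological groupoid, described by its space of arrows `G`. The unit space is the subspace
`{x | r x = x}` of `G`. The product `mul γ γ'` is meaningful only for composable pairs, that is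
when `s γ = r γ'`; nothing is required of it elsewhere. -/
class TopGroupoid (G : Type u) [TopologicalSpace G] where
  /-- range -/
  r : G → G
  /-- source -/
  s : G → G
  /-- inverse -/
  inv : G → G
  /-- product of composable arrows -/
  mul : G → G → G
  r_r : ∀ γ, r (r γ) = r γ
  s_r : ∀ γ, s (r γ) = r γ
  r_s : ∀ γ, r (s γ) = s γ
  s_s : ∀ γ, s (s γ) = s γ
  r_mul : ∀ γ γ', s γ = r γ' → r (mul γ γ') = r γ
  s_mul : ∀ γ γ', s γ = r γ' → s (mul γ γ') = s γ'
  mul_assoc : ∀ γ γ' γ'', s γ = r γ' → s γ' = r γ'' →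
    mul (mul γ γ') γ'' = mul γ (mul γ' γ'')
  r_mul_self : ∀ γ, mul (r γ) γ = γ
  mul_s_self : ∀ γ, mul γ (s γ) = γ
  r_inv : ∀ γ, r (inv γ) = s γ
  s_inv : ∀ γ, s (inv γ) = r γ
  mul_inv_self : ∀ γ, mul γ (inv γ) = r γ
  inv_mul_self : ∀ γ, mul (inv γ) γ = s γ
  continuous_r : Continuous r
  continuous_s : Continuous s
  continuous_inv : Continuous inv
  continuousOn_mul : ContinuousOn (fun p : G × G => mul p.1 p.2) {p | s p.1 = r p.2}

open TopGroupoid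

section Groupoid

variable (G : Type u) [TopologicalSpace G] [TopGroupoid G]

/-- The unit space `G⁽⁰⁾`, with the topology induced by `G`. -/
abbrev UnitSpace : Type u := {x : G // r x = x}

variable {G}

/-- The range map `G → G⁽⁰⁾`. -/
def rangeMap (γ : G) : UnitSpace G := ⟨r γ, r_r γ⟩

/-- The source map `G → G⁽⁰⁾`. -/
def sourceMap (γ : G) : UnitSpace G := ⟨s γ, r_s γ⟩

lemma source_unit (x : UnitSpace G) : s (x : G) = x := by
  have h := s_r (x : G)
  rwa [x.2] at h

variable (G)

/-- `G` is étale: its range map is a local homeomorphism onto the unit space. (As the inverse map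
is a homeomorphism exchanging `r` and `s`, the same then holds for the source map.) -/
def IsEtale : Prop := IsLocalHomeomorph (rangeMap : G → UnitSpace G)

/-- `G` is essentially principal: the interior of the isotropy bundle is the unit space. -/
def IsEssentiallyPrincipal : Prop :=
  interior {γ : G | r γ = s γ} = {γ : G | r γ = γ}

end Groupoid

/-- A twist over `G`: a central extension `𝕋 × G⁽⁰⁾ → E → G` of topological groupoids. Here
`𝕋 × G⁽⁰⁾` is the trivial bundle of groups; `i` identifies it with a topological subgroupoid of `E`
which is the kernel of `q`, and `q` is the quotient map of `E` onto `G = E / 𝕋`. -/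
structure Twist (G : Type u) (E : Type v) [TopologicalSpace G] [TopGroupoid G]
    [TopologicalSpace E] [TopGroupoid E] where
  /-- the inclusion `𝕋 × G⁽⁰⁾ → E` -/
  i : Circle × UnitSpace G → E
  /-- the projection `E → G` -/
  q : E → G
  isEmbedding_i : Topology.IsEmbedding i
  r_i : ∀ z x, r (i (z, x)) = i (1, x)
  s_i : ∀ z x, s (i (z, x)) = i (1, x)
  i_mul : ∀ z w x, i (z * w, x) = mul (i (z, x)) (i (w, x))
  isOpenQuotientMap_q : IsOpenQuotientMap q
  q_r : ∀ σ, q (r σ) = r (q σ)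
  q_s : ∀ σ, q (s σ) = s (q σ)
  q_mul : ∀ σ τ, s σ = r τ → q (mul σ τ) = mul (q σ) (q τ)
  q_i : ∀ z x, q (i (z, x)) = x
  exact : ∀ σ, r (q σ) = q σ → ∃ z x, σ = i (z, x)
  central : ∀ z σ, mul (i (z, rangeMap (q σ))) σ = mul σ (i (z, sourceMap (q σ)))

namespace Twist

variable {G : Type u} {E : Type v} [TopologicalSpace G] [TopGroupoid G]
  [TopologicalSpace E] [TopGroupoid E] (t : Twist G E)

/-- The action of the circle on `E`. -/
def act (z : Circle) (σ : E) : E := mul (t.i (z, rangeMap (t.q σ))) σ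

lemma i_one_of_unit (σ : E) (hσ : r σ = σ) (x : UnitSpace G) (hx : t.q σ = x) :
    σ = t.i (1, x) := by
  have h : r (t.q σ) = t.q σ := by rw [← t.q_r, hσ]
  obtain ⟨z, y, rfl⟩ := t.exact σ h
  rw [t.q_i] at hx
  obtain rfl := Subtype.ext hx
  rw [← hσ, t.r_i]

lemma r_eq (σ : E) : r σ = t.i (1, rangeMap (t.q σ)) :=
  t.i_one_of_unit _ (r_r σ) _ (t.q_r σ)

lemma s_eq (σ : E) : s σ = t.i (1, sourceMap (t.q σ)) :=
  t.i_one_of_unit _ (r_s σ) _ (t.q_s σ)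

lemma q_act (z : Circle) (σ : E) : t.q (t.act z σ) = t.q σ := by
  have h : s (t.i (z, rangeMap (t.q σ))) = r σ := by rw [t.s_i, t.r_eq]
  rw [act, t.q_mul _ _ h, t.q_i]
  exact r_mul_self _

lemma exists_act_of_q_eq {σ τ : E} (h : t.q σ = t.q τ) : ∃ z, σ = t.act z τ := by
  have hs : s σ = s τ := by
    rw [t.s_eq, t.s_eq, h]
  have hr : r σ = r τ := by rw [t.r_eq, t.r_eq, h]
  have hc : s σ = r (inv τ) := by rw [r_inv, hs]
  have hq : t.q (mul σ (inv τ)) = r (t.q τ) := by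
    have h2 : t.q (mul τ (inv τ)) = t.q (mul σ (inv τ)) := by
      rw [t.q_mul _ _ hc, t.q_mul _ _ (r_inv τ).symm, h]
    rw [← h2, mul_inv_self, t.q_r]
  obtain ⟨z, x, hzx⟩ := t.exact (mul σ (inv τ)) (by rw [hq, r_r])
  have hx : x = rangeMap (t.q τ) := by
    apply Subtype.ext
    have h3 := t.q_i z x
    rw [← hzx, hq] at h3
    exact h3.symm
  refine ⟨z, ?_⟩
  rw [act, ← hx, ← hzx, mul_assoc _ _ _ hc (s_inv τ), inv_mul_self, ← hs, mul_s_self]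

lemma act_i (z w : Circle) (x : UnitSpace G) : t.act z (t.i (w, x)) = t.i (z * w, x) := by
  have h : rangeMap (t.q (t.i (w, x))) = x := by
    apply Subtype.ext
    change r (t.q (t.i (w, x))) = x
    rw [t.q_i, x.2]
  rw [act, h, t.i_mul]

/-- A set-theoretic choice of a point of `E` above each arrow of `G`. All the quantities below which
are written by means of it do not depend on the choice. -/
def lift (γ : G) : E := (t.isOpenQuotientMap_q.surjective γ).choose

lemma q_lift (γ : G) : t.q (t.lift γ) = γ := (t.isOpenQuotientMap_q.surjective γ).choose_spec

/-- Sections of the line bundle `L = (ℂ × E) / 𝕋`, seen as functions on `E`. -/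
def IsEquivariant (f : E → ℂ) : Prop := ∀ (z : Circle) σ, f (t.act z σ) = f σ * conj (z : ℂ)

/-- The space `C_c(G, E)` of continuous sections with compact support in `G`. -/
def IsCcSection (f : E → ℂ) : Prop :=
  Continuous f ∧ t.IsEquivariant f ∧ ∃ K : Set G, IsCompact K ∧ ∀ σ, t.q σ ∉ K → f σ = 0

/-- The fibre `L_γ` of the line bundle: equivariant functions on `q ⁻¹ {γ}` (extended by `0`). -/
def fibre (γ : G) : Submodule ℂ (E → ℂ) where
  carrier := {φ | t.IsEquivariant φ ∧ ∀ σ, t.q σ ≠ γ → φ σ = 0}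
  zero_mem' := ⟨fun _ _ => by simp, fun _ _ => rfl⟩
  add_mem' := by
    rintro φ ψ ⟨h1, h2⟩ ⟨h3, h4⟩
    refine ⟨fun z σ => ?_, fun σ hσ => ?_⟩
    · simp only [Pi.add_apply, h1 z σ, h3 z σ]; ring
    · simp [h2 σ hσ, h4 σ hσ]
  smul_mem' := by
    rintro c φ ⟨h1, h2⟩
    refine ⟨fun z σ => ?_, fun σ hσ => ?_⟩
    · simp only [Pi.smul_apply, smul_eq_mul, h1 z σ]; ring
    · simp [h2 σ hσ]

/-- The line `L_γ` as a type. -/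
def Fibre (γ : G) : Type v := t.fibre γ

instance (γ : G) : AddCommGroup (t.Fibre γ) := inferInstanceAs (AddCommGroup (t.fibre γ))
instance (γ : G) : Module ℂ (t.Fibre γ) := inferInstanceAs (Module ℂ (t.fibre γ))
instance (γ : G) : CoeFun (t.Fibre γ) (fun _ => E → ℂ) := ⟨fun φ => φ.1⟩

@[simp] lemma Fibre.add_apply {γ : G} (φ ψ : t.Fibre γ) (σ : E) : (φ + ψ) σ = φ σ + ψ σ := rfl
@[simp] lemma Fibre.smul_apply {γ : G} (c : ℂ) (φ : t.Fibre γ) (σ : E) :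
    (c • φ) σ = c * φ σ := rfl
@[simp] lemma Fibre.zero_apply {γ : G} (σ : E) : (0 : t.Fibre γ) σ = 0 := rfl

@[ext] lemma Fibre.ext {γ : G} {φ ψ : t.Fibre γ} (h : ∀ σ, φ σ = ψ σ) : φ = ψ :=
  Subtype.ext (funext h)

lemma Fibre.eq_zero {γ : G} (φ : t.Fibre γ) (h : φ (t.lift γ) = 0) : φ = 0 := by
  ext σ
  by_cases hσ : t.q σ = γ
  · obtain ⟨z, rfl⟩ := t.exists_act_of_q_eq (hσ.trans (t.q_lift γ).symm)
    rw [φ.2.1 z, h]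
    simp
  · exact φ.2.2 σ hσ

/-- The inner product `⟨φ, ψ⟩ = conj (φ σ) * ψ σ` of `L_γ`, where `σ` is any point above `γ`. -/
@[reducible] def fibreCore (γ : G) : InnerProductSpace.Core ℂ (t.Fibre γ) where
  inner φ ψ := conj (φ (t.lift γ)) * ψ (t.lift γ)
  conj_inner_symm φ ψ := by simp [mul_comm]
  re_inner_nonneg φ := by
    rw [← Complex.normSq_eq_conj_mul_self]
    simpa using Complex.normSq_nonneg _
  add_left φ ψ χ := by simp [add_mul]
  smul_left φ ψ c := by simp [_root_.mul_assoc]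
  definite φ h := by
    apply Fibre.eq_zero
    simpa using h

instance (γ : G) : NormedAddCommGroup (t.Fibre γ) := (t.fibreCore γ).toNormedAddCommGroup
instance (γ : G) : InnerProductSpace ℂ (t.Fibre γ) := InnerProductSpace.ofCore (t.fibreCore γ).toCore

instance (γ : G) : FiniteDimensional ℂ (t.Fibre γ) :=
  FiniteDimensional.of_injective
    ({ toFun := fun φ => φ (t.lift γ)
       map_add' := fun _ _ => rfl
       map_smul' := fun _ _ => rfl } : t.Fibre γ →ₗ[ℂ] ℂ)
    ((injective_iff_map_eq_zero _).2 fun φ h => Fibre.eq_zero t φ h)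

instance (γ : G) : CompleteSpace (t.Fibre γ) := FiniteDimensional.complete ℂ _

lemma Fibre.inner_eq {γ : G} (φ ψ : t.Fibre γ) (σ : E) (hσ : t.q σ = γ) :
    inner ℂ φ ψ = conj (φ σ) * ψ σ := by
  obtain ⟨z, rfl⟩ := t.exists_act_of_q_eq (hσ.trans (t.q_lift γ).symm)
  rw [φ.2.1 z, ψ.2.1 z]
  change conj (φ (t.lift γ)) * ψ (t.lift γ) = _
  have hz : (z : ℂ) * conj (z : ℂ) = 1 := by
    rw [Complex.mul_conj]; simp
  simp only [map_mul, Complex.conj_conj]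
  linear_combination (-(conj (φ (t.lift γ)) * ψ (t.lift γ))) * hz

/-- The Hilbert space `H_x = L²(G_x, L_x, λ_x)` of square-summable sections of `L` over
`G_x = s ⁻¹ {x}`, where `λ_x` is the counting measure. -/
def H (x : UnitSpace G) : Type (max u v) :=
  lp (fun γ : {γ : G // s γ = (x : G)} => t.Fibre (γ : G)) 2

instance (x : UnitSpace G) : NormedAddCommGroup (t.H x) :=
  inferInstanceAs (NormedAddCommGroup (lp (fun γ : {γ : G // s γ = (x : G)} => t.Fibre (γ : G)) 2))

instance (x : UnitSpace G) : InnerProductSpace ℂ (t.H x) :=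
  inferInstanceAs (InnerProductSpace ℂ (lp (fun γ : {γ : G // s γ = (x : G)} => t.Fibre (γ : G)) 2))

instance (x : UnitSpace G) : CompleteSpace (t.H x) :=
  inferInstanceAs (CompleteSpace (lp (fun γ : {γ : G // s γ = (x : G)} => t.Fibre (γ : G)) 2))

/-- The value `ξ(γ) ∈ L_γ` of a section `ξ` of `L` over `G_x`. -/
def H.val {t : Twist G E} {x : UnitSpace G} (ξ : t.H x) (γ : {γ : G // s γ = (x : G)}) :
    t.Fibre (γ : G) := ξ.1 γ

/-- The C⋆-algebra `∏ₓ B(H_x)` of bounded families of operators, with the supremum norm. -/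
def Op : Type (max u v) := lp (fun x : UnitSpace G => t.H x →L[ℂ] t.H x) ∞

instance : NonUnitalCStarAlgebra t.Op :=
  inferInstanceAs (NonUnitalCStarAlgebra (lp (fun x : UnitSpace G => t.H x →L[ℂ] t.H x) ∞))

/-- The component in `B(H_x)` of a family of operators. -/
def Op.at {t : Twist G E} (T : t.Op) (x : UnitSpace G) : t.H x →L[ℂ] t.H x := T.1 x

/-- `T = (π_x(f))_x`, where `π_x(f) ξ (σ) = ∑_{τ ∈ G_x} f (σ τ⁻¹) ξ (τ)` for `σ` above `G_x`.
(For `f` in `C_c(G, E)` over an étale `G` the sums are finite, and `π_x(f)` is bounded, uniformly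
in `x`, so that there is exactly one such `T`.) -/
def IsRegularRep (f : E → ℂ) (T : t.Op) : Prop :=
  ∀ (x : UnitSpace G) (ξ : t.H x) (σ : E) (hσ : s (t.q σ) = (x : G)),
    (T.at x ξ).val ⟨t.q σ, hσ⟩ σ =
      ∑' γ : {γ : G // s γ = (x : G)}, f (mul σ (inv (t.lift γ))) * ξ.val γ (t.lift γ)

/-- The reduced C⋆-algebra `C*_red(G, E)`: the closed ⋆-subalgebra of `∏ₓ B(H_x)` generated by
the operators `(π_x(f))_x`, `f ∈ C_c(G, E)`. As `π` is a ⋆-homomorphism for the convolution, this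
is the completion of `C_c(G, E)` for the norm `‖f‖ = sup_x ‖π_x(f)‖`. -/
def reducedCStarAlgebra : NonUnitalStarSubalgebra ℂ t.Op :=
  (NonUnitalStarAlgebra.adjoin ℂ
    {T : t.Op | ∃ f : E → ℂ, t.IsCcSection f ∧ t.IsRegularRep f T}).topologicalClosure

/-- `C*_red(G, E)` as a type. -/
def CStarRed : Type (max u v) := t.reducedCStarAlgebra

instance : NonUnitalCStarAlgebra t.CStarRed :=
  NonUnitalStarSubalgebra.nonUnitalCStarAlgebra t.reducedCStarAlgebra
    (h_closed := NonUnitalStarSubalgebra.isClosed_topologicalClosure _)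

variable {t}

/-- The operator family underlying an element of the reduced C⋆-algebra. -/
def CStarRed.toOp (a : t.CStarRed) : t.Op := a.1

open Classical in
/-- The function on `E` with `z x ↦ conj z` for `z` in the circle, and `0` off the fibre of `x`. -/
def unitFun (t : Twist G E) (x : UnitSpace G) (σ : E) : ℂ :=
  if h : ∃ z : Circle, σ = t.i (z, x) then conj (Circle.coeHom h.choose) else 0

lemma unitFun_i (x : UnitSpace G) (z : Circle) : t.unitFun x (t.i (z, x)) = conj (z : ℂ) := by
  have h : ∃ w : Circle, t.i (z, x) = t.i (w, x) := ⟨z, rfl⟩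
  have h3 : h.choose = z :=
    (Prod.ext_iff.1 (t.isEmbedding_i.injective h.choose_spec)).1.symm
  rw [unitFun, dif_pos h, h3]
  rfl

lemma unitFun_of_q_ne (x : UnitSpace G) (σ : E) (hσ : t.q σ ≠ x) : t.unitFun x σ = 0 := by
  have h : ¬ ∃ z : Circle, σ = t.i (z, x) := by
    rintro ⟨z, rfl⟩
    exact hσ (t.q_i z x)
  rw [unitFun, dif_neg h]

/-- The unit vector of `L_x` defined by `unitFun`. -/
def unitFibre (t : Twist G E) (x : UnitSpace G) : t.Fibre (x : G) :=
  ⟨t.unitFun x, by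
    refine ⟨fun w σ => ?_, t.unitFun_of_q_ne x⟩
    by_cases hσ : t.q σ = x
    · obtain ⟨z, rfl⟩ := t.exists_act_of_q_eq (hσ.trans (t.q_i 1 x).symm)
      rw [act_i, act_i, unitFun_i, unitFun_i]
      simp [mul_comm]
    · rw [unitFun_of_q_ne x σ hσ, unitFun_of_q_ne x _ (by rwa [q_act]), zero_mul]⟩

/-- The unit vector `ε_x` of `H_x`: `ε_x (τ) = conj z` if `τ = z x`, and `0` otherwise. -/
def unitVector (t : Twist G E) (x : UnitSpace G) : t.H x := by
  classical
  exact (lp.single 2 (⟨(x : G), source_unit x⟩ : {γ : G // s γ = (x : G)}) (t.unitFibre x) :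
    lp (fun γ : {γ : G // s γ = (x : G)} => t.Fibre (γ : G)) 2)

/-- An element `a` of the reduced C⋆-algebra, viewed as a section of `L`, i.e. as a function on `E`:
its restriction to `E_x` is `π_x(a) ε_x`. For `a = π(f)` this gives back `f`. -/
def toSection (a : t.CStarRed) (σ : E) : ℂ :=
  (a.toOp.at (sourceMap (t.q σ)) (t.unitVector (sourceMap (t.q σ)))).val ⟨t.q σ, rfl⟩ σ

/-- The restriction of (the section defined by) `a` to the unit space, along which `L` is trivial. -/
def restrict (a : t.CStarRed) (x : UnitSpace G) : ℂ := toSection a (t.i (1, x))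

/-- The canonical inclusion of `C₀(G⁽⁰⁾)` into the reduced C⋆-algebra: the function `h` is
identified with the section `σ ↦ h x * conj z` if `σ = (z, x)` lies in `𝕋 × G⁽⁰⁾`, and `0` elsewhere. -/
def IsUnitSpaceInclusion (ι : C₀(UnitSpace G, ℂ) →⋆ₙₐ[ℂ] t.CStarRed) : Prop :=
  (∀ h z x, toSection (ι h) (t.i (z, x)) = h x * conj (z : ℂ)) ∧
    ∀ h σ, r (t.q σ) ≠ t.q σ → toSection (ι h) σ = 0

end Twist

/-- `Q` is a conditional expectation of the C⋆-algebra `A` onto its sub-C⋆-algebra `ι(B)`: a positive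
contractive linear `B`-bimodule map which is the identity on `B`. -/
structure IsConditionalExpectation {A B : Type*} [NonUnitalCStarAlgebra A] [NonUnitalCStarAlgebra B]
    (ι : B →⋆ₙₐ[ℂ] A) (Q : A →ₗ[ℂ] B) : Prop where
  map_incl : ∀ b, Q (ι b) = b
  norm_le : ∀ a, ‖Q a‖ ≤ ‖a‖
  map_star_mul_self : ∀ a, ∃ b, Q (star a * a) = star b * b
  map_mul_left : ∀ b a, Q (ι b * a) = b * Q a
  map_mul_right : ∀ a b, Q (a * ι b) = Q a * b

/-- A positive map is faithful if it annihilates no nonzero positive element. -/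
def IsFaithful {A B : Type*} [NonUnitalCStarAlgebra A] [NonUnitalCStarAlgebra B]
    (Q : A →ₗ[ℂ] B) : Prop :=
  ∀ a, Q (star a * a) = 0 → a = 0

end TwistedGroupoid
end

/-! The point masses `H.delta` turn an operator on `H_x` into a matrix indexed by `G_x`, up to
phases that equivariance controls. For `f` in `C_c` the matrix of `π_x(f)` is `f (σ τ⁻¹)`. Matrix
entries are norm continuous, so every `a` in `A` has the matrix `a (σ τ⁻¹)`, where `a` is viewed as
a section (`hasKernel_toSection`). An element of `A` is thus determined by its section, and
`P(a)(x)` is the diagonal entry `⟨ε_x, π_x(a) ε_x⟩`.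

Assertions 1 and 2 follow from this. Diagonal entries are bounded by the norm, so `P(a)` is a
uniform limit of restrictions of `C_c` sections and lies in `C₀`. Elements of `C₀(G⁽⁰⁾)` act as
diagonal matrices, which gives the bimodule property. Finally `P(a⋆a)(x) = ‖π_x(a) ε_x‖²`, which is
nonnegative, and if it vanishes for all `x` the section of `a` is zero, so `a = 0`.

That `π(f)` exists, and that these operators form a ⋆-algebra, is checked after a partition of unity
(`IsCcSection.exists_sum`) on sections supported over a bisection. Such a matrix has at most one
nonzero entry in each row and each column, so its norm is at most the supremum of `|f|`
(`Op.exists_hasKernel`), and convolution with such a section is a single term (`convolution_eq`).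

For uniqueness, the bisections can be chosen to consist of units or to contain none. On a section
over units any expectation `Q` is forced, since the section lies in `C₀(G⁽⁰⁾)`. Let `f` live over a
bisection `U` without units, and suppose `Q(f) ≠ 0` on a nonempty open set `O` of units. Essential
principality yields an arrow `γ` in `U` with source in `O` and `r γ ≠ s γ`. A bump `h` near `s γ`
then satisfies `h f h = 0`, so `h² Q(f) = Q(h f h) = 0`, contradicting `Q(f)(s γ) ≠ 0`
(`apply_eq_zero_of_isCcOn`). Density of `C_c` and contractivity conclude. -/

noncomputable section

namespace TwistedGroupoid

open TopGroupoid

/-! ### Cancellation rules in a groupoid. -/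

namespace TopGroupoid

variable {G : Type*} [TopologicalSpace G] [TopGroupoid G]

lemma mul_mul_inv_cancel {a b : G} (h : s a = r b) : mul (mul a b) (inv b) = a := by
  rw [mul_assoc _ _ _ h (r_inv b).symm, mul_inv_self, ← h, mul_s_self]

lemma mul_inv_mul_cancel {a b : G} (h : s a = s b) : mul (mul a (inv b)) b = a := by
  rw [mul_assoc _ _ _ (h.trans (r_inv b).symm) (s_inv b), inv_mul_self, ← h, mul_s_self]

lemma inv_mul_mul_cancel {a b : G} (h : s a = r b) : mul (inv a) (mul a b) = b := by
  rw [← mul_assoc _ _ _ (s_inv a) h, inv_mul_self, h, r_mul_self]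

lemma inv_inv (a : G) : inv (inv a) = a := by
  have h := mul_mul_inv_cancel (a := a) (b := inv a) (r_inv a).symm
  rw [mul_inv_self] at h
  have h2 : r a = r (inv (inv a)) := by rw [r_inv, s_inv]
  rwa [h2, r_mul_self] at h

lemma inv_eq_of_mul_eq {a b : G} (h : s a = r b) (h' : mul a b = r a) : inv a = b := by
  have h2 := inv_mul_mul_cancel h
  rw [h', ← s_inv, mul_s_self] at h2
  exact h2

lemma inv_mul {a b : G} (h : s a = r b) : inv (mul a b) = mul (inv b) (inv a) := by
  have hc : s (inv b) = r (inv a) := by rw [s_inv, r_inv, h]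
  have h2 : s (mul a b) = r (mul (inv b) (inv a)) := by rw [s_mul _ _ h, r_mul _ _ hc, r_inv]
  refine inv_eq_of_mul_eq h2 ?_
  have h3 : s (mul a b) = r (inv b) := by rw [s_mul _ _ h, r_inv]
  rw [← mul_assoc _ _ _ h3 hc, mul_mul_inv_cancel h, mul_inv_self, r_mul _ _ h]

lemma mul_inv_left_injective {a b c : G} (hb : s a = s b) (hc : s a = s c)
    (h : mul a (inv b) = mul a (inv c)) : b = c := by
  have h1 := inv_mul_mul_cancel (a := a) (b := inv b) (by rw [hb, r_inv])
  have h2 := inv_mul_mul_cancel (a := a) (b := inv c) (by rw [hc, r_inv])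
  rw [← inv_inv b, ← inv_inv c, ← h1, ← h2, h]

lemma mul_inv_right_injective {a b c : G} (ha : s a = s c) (hb : s b = s c)
    (h : mul a (inv c) = mul b (inv c)) : a = b := by
  rw [← mul_inv_mul_cancel ha, ← mul_inv_mul_cancel hb, h]

lemma mul_inv_eq_unit {a b : G} (h : s a = s b) (h' : r (mul a (inv b)) = mul a (inv b)) :
    a = b := by
  have hc : s a = r (inv b) := by rw [r_inv, h]
  have h1 := mul_inv_mul_cancel h
  rw [r_mul _ _ hc] at h'
  have h2 : s (r a) = r b := by rw [h', s_mul _ _ hc, s_inv]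
  rw [s_r] at h2
  rw [← h1, ← h', h2, r_mul_self]

lemma s_eq_of_unit {x : G} (h : r x = x) : s x = x := by
  rw [← h, s_r]

lemma inv_unit {x : G} (h : r x = x) : inv x = x := by
  refine inv_eq_of_mul_eq (by rw [s_eq_of_unit h, h]) ?_
  have h2 := r_mul_self x
  rw [h] at h2
  rw [h2, h]

end TopGroupoid

/-! ### The circle action on the twist and equivariant functions. -/

namespace Twist

variable {G : Type*} {E : Type*} [TopologicalSpace G] [TopGroupoid G]
  [TopologicalSpace E] [TopGroupoid E] (t : Twist G E)

lemma s_eq_iff {σ τ : E} : s σ = s τ ↔ s (t.q σ) = s (t.q τ) := by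
  constructor
  · intro h
    rw [← t.q_s, h, t.q_s]
  · intro h
    rw [t.s_eq, t.s_eq, sourceMap, sourceMap]
    simp only [h]

lemma s_eq_r_iff {σ τ : E} : s σ = r τ ↔ s (t.q σ) = r (t.q τ) := by
  constructor
  · intro h
    rw [← t.q_s, h, t.q_r]
  · intro h
    rw [t.s_eq, t.r_eq, rangeMap, sourceMap]
    simp only [h]

lemma q_inv (σ : E) : t.q (inv σ) = inv (t.q σ) := by
  symm
  have h : s σ = r (inv σ) := (r_inv σ).symm
  refine inv_eq_of_mul_eq (t.s_eq_r_iff.1 h) ?_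
  rw [← t.q_mul _ _ h, mul_inv_self, t.q_r]

lemma q_mul_inv {σ τ : E} (h : s (t.q σ) = s (t.q τ)) :
    t.q (mul σ (inv τ)) = mul (t.q σ) (inv (t.q τ)) := by
  rw [t.q_mul _ _ (by rw [t.s_eq_iff.2 h, r_inv]), q_inv]

lemma r_act (z : Circle) (σ : E) : r (t.act z σ) = r σ := by
  rw [t.r_eq, t.q_act, ← t.r_eq]

lemma s_act (z : Circle) (σ : E) : s (t.act z σ) = s σ := by
  rw [t.s_eq, t.q_act, ← t.s_eq]

lemma act_mul {z : Circle} {σ τ : E} (h : s σ = r τ) :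
    mul (t.act z σ) τ = t.act z (mul σ τ) := by
  have h1 : s (t.i (z, rangeMap (t.q σ))) = r σ := by rw [t.s_i, t.r_eq]
  have h2 : rangeMap (t.q (mul σ τ)) = rangeMap (t.q σ) := by
    apply Subtype.ext
    change r (t.q _) = r (t.q _)
    rw [t.q_mul _ _ h, r_mul _ _ (t.s_eq_r_iff.1 h)]
  rw [act, act, mul_assoc _ _ _ h1 h, h2]

lemma mul_act {z : Circle} {σ τ : E} (h : s σ = r τ) :
    mul σ (t.act z τ) = t.act z (mul σ τ) := by
  have h0 : rangeMap (t.q τ) = sourceMap (t.q σ) := Subtype.ext (t.s_eq_r_iff.1 h).symm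
  have h1 : s σ = r (t.i (z, rangeMap (t.q τ))) := by rw [t.r_i, h, t.r_eq]
  have h2 : s (t.i (z, rangeMap (t.q τ))) = r τ := by rw [t.s_i, t.r_eq]
  rw [← t.act_mul h, act, act, ← mul_assoc _ _ _ h1 h2, h0, t.central]

lemma act_act (z w : Circle) (σ : E) : t.act z (t.act w σ) = t.act (z * w) σ := by
  have h1 : s (t.i (w, rangeMap (t.q σ))) = r σ := by rw [t.s_i, t.r_eq]
  conv_lhs => rw [act.eq_def t w σ]
  rw [← t.act_mul h1, act_i, act]

lemma act_one (σ : E) : t.act 1 σ = σ := by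
  rw [act, ← t.r_eq, r_mul_self]

lemma inv_act (z : Circle) (σ : E) : inv (t.act z σ) = t.act z⁻¹ (inv σ) := by
  have h : s (t.act z σ) = r (t.act z⁻¹ (inv σ)) := by rw [s_act, r_act, r_inv]
  refine inv_eq_of_mul_eq h ?_
  have h' : s σ = r (t.act z⁻¹ (inv σ)) := by rw [r_act, r_inv]
  rw [t.act_mul h', t.mul_act (r_inv σ).symm, act_act, mul_inv_cancel, act_one, mul_inv_self,
    r_act]

lemma inv_i_one (x : UnitSpace G) : inv (t.i (1, x)) = t.i (1, x) :=
  inv_unit (t.r_i 1 x)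

lemma rangeMap_unit (x : UnitSpace G) : rangeMap (x : G) = x := Subtype.ext x.2

lemma rangeMap_q_i (z : Circle) (x : UnitSpace G) : rangeMap (t.q (t.i (z, x))) = x := by
  rw [t.q_i, rangeMap_unit]

lemma circle_mul_conj (z : Circle) : (z : ℂ) * conj (z : ℂ) = 1 := by
  rw [Complex.mul_conj]; simp

lemma circle_inv (z : Circle) : ((z⁻¹ : Circle) : ℂ) = conj (z : ℂ) := Circle.coe_inv_eq_conj z

variable {t}

lemma IsEquivariant.norm_eq {f : E → ℂ} (hf : t.IsEquivariant f) {σ τ : E}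
    (h : t.q σ = t.q τ) : ‖f σ‖ = ‖f τ‖ := by
  obtain ⟨z, rfl⟩ := t.exists_act_of_q_eq h
  rw [hf, norm_mul, RCLike.norm_conj, Circle.norm_coe, mul_one]

lemma IsEquivariant.mul_inv_act {f : E → ℂ} (hf : t.IsEquivariant f) (z : Circle) {σ τ : E}
    (h : s σ = s τ) : f (mul σ (inv (t.act z τ))) = f (mul σ (inv τ)) * z := by
  rw [inv_act, t.mul_act (by rw [h, r_inv]), hf, circle_inv, Complex.conj_conj]

/-- The product of the kernel `f (σ τ⁻¹)` with an equivariant function of `τ` depends only on the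
arrow below `τ`. -/
lemma IsEquivariant.mul_inv_mul {f g : E → ℂ} (hf : t.IsEquivariant f) (hg : t.IsEquivariant g)
    {σ τ τ' : E} (h : s σ = s τ) (hq : t.q τ' = t.q τ) :
    f (mul σ (inv τ')) * g τ' = f (mul σ (inv τ)) * g τ := by
  obtain ⟨z, rfl⟩ := t.exists_act_of_q_eq hq
  rw [hf.mul_inv_act z h, hg]
  linear_combination (f (mul σ (inv τ)) * g τ) * circle_mul_conj z

end Twist

/-! ### Coordinates on the Hilbert spaces `H_x`. -/

namespace Twist

variable {G : Type*} {E : Type*} [TopologicalSpace G] [TopGroupoid G]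
  [TopologicalSpace E] [TopGroupoid E] {t : Twist G E}

lemma Fibre.norm_eq {γ : G} (φ : t.Fibre γ) {σ : E} (hσ : t.q σ = γ) : ‖φ‖ = ‖φ σ‖ := by
  have h := inner_self_eq_norm_sq_to_K (𝕜 := ℂ) φ
  rw [Fibre.inner_eq t φ φ σ hσ, mul_comm, Complex.mul_conj, Complex.normSq_eq_norm_sq] at h
  have h2 : ‖φ‖ ^ 2 = ‖φ σ‖ ^ 2 := Complex.ofReal_injective (by simpa using h.symm)
  exact (pow_left_inj₀ (norm_nonneg _) (norm_nonneg _) two_ne_zero).1 h2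

lemma Fibre.ext_of_apply_eq {γ : G} {φ ψ : t.Fibre γ} {σ : E} (hσ : t.q σ = γ)
    (h : φ σ = ψ σ) : φ = ψ := by
  rw [← sub_eq_zero, ← norm_eq_zero, Fibre.norm_eq (φ - ψ) hσ, norm_eq_zero]
  exact sub_eq_zero.2 h

open Classical in
/-- The element of `L_γ` obtained by restricting an equivariant function. -/
def Fibre.ofFun (γ : G) (F : E → ℂ)
    (hF : ∀ (z : Circle) σ, t.q σ = γ → F (t.act z σ) = F σ * conj (z : ℂ)) : t.Fibre γ :=
  ⟨fun σ => if t.q σ = γ then F σ else 0, by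
    refine ⟨fun z σ => ?_, fun σ hσ => if_neg hσ⟩
    by_cases h : t.q σ = γ
    · simp only [q_act, if_pos h, hF z σ h]
    · simp only [q_act, if_neg h, zero_mul]⟩

lemma Fibre.ofFun_apply {γ : G} {F : E → ℂ}
    (hF : ∀ (z : Circle) σ, t.q σ = γ → F (t.act z σ) = F σ * conj (z : ℂ)) {σ : E}
    (hσ : t.q σ = γ) : Fibre.ofFun γ F hF σ = F σ := if_pos hσ

namespace H

variable {x : UnitSpace G}

open Classical in
/-- The value at `σ` of an element of `H_x`, seen as a function on `E` vanishing off `s⁻¹(x)`. -/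
def ev (ξ : t.H x) (σ : E) : ℂ := if h : s (t.q σ) = (x : G) then ξ.val ⟨t.q σ, h⟩ σ else 0

lemma ev_eq (ξ : t.H x) {σ : E} (h : s (t.q σ) = (x : G)) : ξ.ev σ = ξ.val ⟨t.q σ, h⟩ σ :=
  dif_pos h

/-- Removes the dependence of the fibre type on the arrow: `γ` and `t.q σ` are only propositionally
equal, and `ev` is a plain function on `E`. -/
lemma val_apply (ξ : t.H x) (γ : {γ : G // s γ = (x : G)}) {σ : E} (h : t.q σ = γ) :
    ξ.val γ σ = ξ.ev σ := by
  obtain ⟨γ, hγ⟩ := γ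
  obtain rfl : t.q σ = γ := h
  rw [ev_eq ξ hγ]

lemma norm_val (ξ : t.H x) (γ : {γ : G // s γ = (x : G)}) :
    ‖ξ.val γ‖ = ‖ξ.ev (t.lift γ)‖ := by
  rw [Fibre.norm_eq (ξ.val γ) (t.q_lift _), val_apply ξ γ (t.q_lift _)]

lemma ev_act (ξ : t.H x) (z : Circle) (σ : E) : ξ.ev (t.act z σ) = ξ.ev σ * conj (z : ℂ) := by
  by_cases h : s (t.q σ) = (x : G)
  · have h' : t.q (t.act z σ) = t.q σ := t.q_act z σ
    rw [ev_eq ξ h, ← val_apply ξ ⟨t.q σ, h⟩ h']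
    exact (ξ.val ⟨t.q σ, h⟩).2.1 z σ
  · rw [ev, ev, dif_neg h, dif_neg (by rwa [q_act]), zero_mul]

lemma isEquivariant_ev (ξ : t.H x) : t.IsEquivariant ξ.ev := ξ.ev_act

lemma ext_ev {ξ η : t.H x} (h : ∀ σ, s (t.q σ) = (x : G) → ξ.ev σ = η.ev σ) : ξ = η := by
  refine Subtype.ext (funext fun γ => ?_)
  refine Fibre.ext_of_apply_eq (t.q_lift (γ : G)) ?_
  have h1 := h (t.lift γ) (by rw [q_lift]; exact γ.2)
  rwa [← val_apply ξ γ (t.q_lift _), ← val_apply η γ (t.q_lift _)] at h1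

lemma ev_add (ξ η : t.H x) (σ : E) : (ξ + η).ev σ = ξ.ev σ + η.ev σ := by
  by_cases h : s (t.q σ) = (x : G)
  · rw [ev_eq _ h, ev_eq _ h, ev_eq _ h]; rfl
  · rw [ev, ev, ev, dif_neg h, dif_neg h, dif_neg h, add_zero]

lemma ev_smul (c : ℂ) (ξ : t.H x) (σ : E) : (c • ξ).ev σ = c * ξ.ev σ := by
  by_cases h : s (t.q σ) = (x : G)
  · rw [ev_eq _ h, ev_eq _ h]; rfl
  · rw [ev, ev, dif_neg h, dif_neg h, mul_zero]

lemma norm_ev_le (ξ : t.H x) (σ : E) : ‖ξ.ev σ‖ ≤ ‖ξ‖ := by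
  by_cases h : s (t.q σ) = (x : G)
  · rw [ev_eq _ h, ← Fibre.norm_eq _ rfl]
    exact lp.norm_apply_le_norm (by norm_num)
      (ξ : lp (fun γ : {γ : G // s γ = (x : G)} => t.Fibre (γ : G)) 2) ⟨t.q σ, h⟩
  · rw [ev, dif_neg h, norm_zero]; exact norm_nonneg _

variable (t x) in
/-- Evaluation at a point of `E`, as a continuous linear form on `H_x`. -/
def evL (σ : E) : t.H x →L[ℂ] ℂ :=
  LinearMap.mkContinuous
    { toFun := fun ξ => ξ.ev σ
      map_add' := fun ξ η => ev_add ξ η σ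
      map_smul' := fun c ξ => ev_smul c ξ σ } 1 fun ξ => by
        rw [one_mul]; exact norm_ev_le ξ σ

@[simp] lemma evL_apply (σ : E) (ξ : t.H x) : evL t x σ ξ = ξ.ev σ := rfl

lemma ev_zero (σ : E) : (0 : t.H x).ev σ = 0 := (evL t x σ).map_zero

lemma unitFun_mul_inv_act (τ : E) (z : Circle) (σ : E) (h : t.q σ = t.q τ) :
    t.unitFun (rangeMap (t.q τ)) (mul (t.act z σ) (inv τ)) =
      t.unitFun (rangeMap (t.q τ)) (mul σ (inv τ)) * conj (z : ℂ) := by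
  have hs : s σ = s τ := t.s_eq_iff.2 (by rw [h])
  rw [t.act_mul (by rw [hs, r_inv])]
  exact (t.unitFibre _).2.1 z _

variable (t) in
/-- The element of the line above `q τ` with value `1` at `τ`. -/
def fibreDelta (τ : E) : t.Fibre (t.q τ) :=
  Fibre.ofFun (t.q τ) (fun σ => t.unitFun (rangeMap (t.q τ)) (mul σ (inv τ)))
    (unitFun_mul_inv_act τ)

lemma fibreDelta_self (τ : E) : fibreDelta t τ τ = 1 := by
  rw [fibreDelta, Fibre.ofFun_apply _ rfl, mul_inv_self, t.r_eq, unitFun_i]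
  simp

/-- The vector of `H_x` supported at the arrow `γ`, with value `φ ∈ L_γ`. -/
def single (γ : {γ : G // s γ = (x : G)}) (φ : t.Fibre (γ : G)) : t.H x := by
  classical
  exact (lp.single 2 γ φ : lp (fun γ : {γ : G // s γ = (x : G)} => t.Fibre (γ : G)) 2)

lemma ev_single_of_eq {γ : {γ : G // s γ = (x : G)}} (φ : t.Fibre (γ : G)) {σ : E}
    (h : t.q σ = γ) : (single γ φ).ev σ = φ σ := by
  classical
  rw [← val_apply _ γ h]
  have h1 : (single γ φ).val γ = φ :=
    lp.single_apply_self (E := fun γ : {γ : G // s γ = (x : G)} => t.Fibre (γ : G)) 2 γ φ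
  rw [h1]

lemma ev_single_of_ne {γ : {γ : G // s γ = (x : G)}} (φ : t.Fibre (γ : G)) {σ : E}
    (h : t.q σ ≠ γ) : (single γ φ).ev σ = 0 := by
  classical
  by_cases hs : s (t.q σ) = (x : G)
  · rw [ev_eq _ hs]
    have h1 : (single γ φ).val ⟨t.q σ, hs⟩ = 0 :=
      lp.single_apply_ne (E := fun γ : {γ : G // s γ = (x : G)} => t.Fibre (γ : G)) 2 γ φ
        (j := ⟨t.q σ, hs⟩) (fun h2 => h (Subtype.ext_iff.1 h2))
    rw [h1]; rfl
  · rw [ev, dif_neg hs]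

/-- The vector of `H_x` supported on the fibre of `τ`, with value `1` at `τ`. -/
def delta (x : UnitSpace G) (τ : E) (hτ : s (t.q τ) = (x : G)) : t.H x :=
  single ⟨t.q τ, hτ⟩ (fibreDelta t τ)

lemma ev_delta_self (τ : E) (hτ : s (t.q τ) = (x : G)) : (delta x τ hτ).ev τ = 1 := by
  rw [delta, ev_single_of_eq _ rfl, fibreDelta_self]

lemma ev_delta_of_ne (τ : E) (hτ : s (t.q τ) = (x : G)) {σ : E} (h : t.q σ ≠ t.q τ) :
    (delta x τ hτ).ev σ = 0 := ev_single_of_ne _ h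

lemma norm_delta (τ : E) (hτ : s (t.q τ) = (x : G)) : ‖delta x τ hτ‖ = 1 := by
  classical
  have h := lp.norm_single (E := fun γ : {γ : G // s γ = (x : G)} => t.Fibre (γ : G)) (p := 2)
    (by norm_num) ⟨t.q τ, hτ⟩ (fibreDelta t τ)
  refine h.trans ?_
  rw [Fibre.norm_eq (fibreDelta t τ) rfl, fibreDelta_self, norm_one]

lemma single_eq_smul_delta (γ : {γ : G // s γ = (x : G)}) (φ : t.Fibre (γ : G)) {τ : E}
    (hτ : t.q τ = γ) : single γ φ = φ τ • delta x τ (by rw [hτ]; exact γ.2) := by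
  refine ext_ev fun σ _ => ?_
  rw [ev_smul]
  by_cases h : t.q σ = t.q τ
  · obtain ⟨z, rfl⟩ := t.exists_act_of_q_eq h
    rw [ev_act, ev_act, ev_delta_self, ev_single_of_eq φ hτ, one_mul]
  · rw [ev_delta_of_ne _ _ h, ev_single_of_ne _ (by rwa [← hτ]), mul_zero]

lemma delta_lift_source (γ : {γ : G // s γ = (x : G)}) : s (t.q (t.lift (γ : G))) = (x : G) := by
  rw [q_lift]; exact γ.2

/-- The point masses at the chosen lifts form an orthonormal basis, each fibre being a line. This
expansion reduces identities between operators to identities between matrix entries. -/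
lemma hasSum_delta (ξ : t.H x) :
    HasSum (fun γ : {γ : G // s γ = (x : G)} =>
      ξ.ev (t.lift γ) • delta x (t.lift γ) (delta_lift_source γ)) ξ := by
  classical
  have h := lp.hasSum_single (E := fun γ : {γ : G // s γ = (x : G)} => t.Fibre (γ : G)) (p := 2)
    (by norm_num) ξ
  have h2 : (fun γ : {γ : G // s γ = (x : G)} =>
      ξ.ev (t.lift γ) • delta x (t.lift γ) (delta_lift_source γ)) =
      fun γ => single γ (ξ.val γ) := by
    funext γ
    rw [single_eq_smul_delta γ (ξ.val γ) (t.q_lift _), val_apply ξ γ (t.q_lift _)]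
  rw [h2]
  exact h

lemma inner_delta (τ : E) (hτ : s (t.q τ) = (x : G)) (ξ : t.H x) :
    inner ℂ (delta x τ hτ) ξ = ξ.ev τ := by
  classical
  have h := lp.inner_single_left (𝕜 := ℂ) (G := fun γ : {γ : G // s γ = (x : G)} => t.Fibre (γ : G))
    ⟨t.q τ, hτ⟩ (fibreDelta t τ) ξ
  refine h.trans ?_
  rw [Fibre.inner_eq t _ _ τ rfl, fibreDelta_self, map_one, one_mul]
  exact val_apply ξ ⟨t.q τ, hτ⟩ rfl

lemma unitVector_eq_delta (x : UnitSpace G) :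
    t.unitVector x = delta x (t.i (1, x)) (by rw [q_i, source_unit]) := by
  have h := single_eq_smul_delta (⟨(x : G), source_unit x⟩ : {γ : G // s γ = (x : G)})
    (t.unitFibre x) (τ := t.i (1, x)) (t.q_i 1 x)
  have h2 : (t.unitFibre x) (t.i (1, x)) = 1 := by
    refine (unitFun_i x 1).trans ?_
    simp
  rw [h2, one_smul] at h
  exact h

end H

open H

/-! ### Matrix coefficients and operators given by a kernel. -/

namespace Op

lemma ext_at {S T : t.Op} (h : ∀ x, S.at x = T.at x) : S = T := Subtype.ext (funext h)

lemma at_add (S T : t.Op) (x : UnitSpace G) : (S + T).at x = S.at x + T.at x := rfl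

lemma at_smul (c : ℂ) (T : t.Op) (x : UnitSpace G) : (c • T).at x = c • T.at x := rfl

lemma at_mul (S T : t.Op) (x : UnitSpace G) (ξ : t.H x) : (S * T).at x ξ = S.at x (T.at x ξ) := rfl

lemma at_star (T : t.Op) (x : UnitSpace G) :
    (star T).at x = ContinuousLinearMap.adjoint (T.at x) := rfl

lemma at_zero (x : UnitSpace G) : (0 : t.Op).at x = 0 := rfl

lemma norm_at_le (T : t.Op) (x : UnitSpace G) : ‖T.at x‖ ≤ ‖T‖ :=
  lp.norm_apply_le_norm (by norm_num) (T : lp (fun x : UnitSpace G => t.H x →L[ℂ] t.H x) ∞) x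

lemma norm_le {T : t.Op} {C : ℝ} (hC : 0 ≤ C) (h : ∀ x, ‖T.at x‖ ≤ C) : ‖T‖ ≤ C :=
  lp.norm_le_of_forall_le (f := (T : lp (fun x : UnitSpace G => t.H x →L[ℂ] t.H x) ∞)) hC h

/-- A uniformly bounded family of operators. -/
def ofFamily (T : ∀ x : UnitSpace G, t.H x →L[ℂ] t.H x) (C : ℝ) (h : ∀ x, ‖T x‖ ≤ C) : t.Op :=
  (⟨T, memℓp_infty ⟨C, by rintro _ ⟨x, rfl⟩; exact h x⟩⟩ :
    lp (fun x : UnitSpace G => t.H x →L[ℂ] t.H x) ∞)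

variable (t) in
/-- The component at `x` of a family of operators, as a continuous linear map. -/
def atL (x : UnitSpace G) : t.Op →L[ℂ] (t.H x →L[ℂ] t.H x) :=
  LinearMap.mkContinuous
    { toFun := fun T => T.at x
      map_add' := fun S T => at_add S T x
      map_smul' := fun c T => at_smul c T x } 1 fun T => by
        rw [one_mul]; exact norm_at_le T x

@[simp] lemma atL_apply (T : t.Op) (x : UnitSpace G) : atL t x T = T.at x := rfl

/-- The matrix coefficient of `T` at a pair of points of `E` with the same source. -/
def coeff (T : t.Op) (x : UnitSpace G) (τ : E) (hτ : s (t.q τ) = (x : G)) (σ : E) : ℂ :=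
  (T.at x (delta x τ hτ)).ev σ

lemma coeff_add (S T : t.Op) (x : UnitSpace G) (τ : E) (hτ : s (t.q τ) = (x : G)) (σ : E) :
    (S + T).coeff x τ hτ σ = S.coeff x τ hτ σ + T.coeff x τ hτ σ := by
  rw [coeff, at_add, _root_.add_apply, ev_add]; rfl

lemma coeff_smul (c : ℂ) (T : t.Op) (x : UnitSpace G) (τ : E) (hτ : s (t.q τ) = (x : G)) (σ : E) :
    (c • T).coeff x τ hτ σ = c * T.coeff x τ hτ σ := by
  rw [coeff, at_smul, _root_.smul_apply, ev_smul]; rfl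

lemma norm_coeff_le (T : t.Op) (x : UnitSpace G) (τ : E) (hτ : s (t.q τ) = (x : G)) (σ : E) :
    ‖T.coeff x τ hτ σ‖ ≤ ‖T‖ := by
  refine (norm_ev_le _ _).trans (((T.at x).le_opNorm _).trans ?_)
  rw [norm_delta, mul_one]
  exact norm_at_le T x

lemma continuous_coeff (x : UnitSpace G) (τ : E) (hτ : s (t.q τ) = (x : G)) (σ : E) :
    Continuous fun T : t.Op => T.coeff x τ hτ σ :=
  (evL t x σ).continuous.comp
    ((ContinuousLinearMap.apply ℂ (t.H x) (delta x τ hτ)).continuous.comp (atL t x).continuous)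

lemma coeff_star (T : t.Op) (x : UnitSpace G) (τ : E) (hτ : s (t.q τ) = (x : G)) (σ : E)
    (hσ : s (t.q σ) = (x : G)) : (star T).coeff x τ hτ σ = conj (T.coeff x σ hσ τ) := by
  rw [coeff, coeff, at_star, ← inner_delta σ hσ, ← inner_delta τ hτ,
    ContinuousLinearMap.adjoint_inner_right, inner_conj_symm]

lemma hasSum_ev (T : t.Op) (x : UnitSpace G) (ξ : t.H x) (σ : E) :
    HasSum (fun γ : {γ : G // s γ = (x : G)} =>
      T.coeff x (t.lift γ) (delta_lift_source γ) σ * ξ.ev (t.lift γ)) ((T.at x ξ).ev σ) := by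
  have h := (hasSum_delta ξ).mapL ((evL t x σ).comp (T.at x))
  have h2 : (fun γ : {γ : G // s γ = (x : G)} =>
      T.coeff x (t.lift γ) (delta_lift_source γ) σ * ξ.ev (t.lift γ)) =
      fun γ : {γ : G // s γ = (x : G)} =>
      ((evL t x σ).comp (T.at x))
        (ξ.ev (t.lift γ) • delta x (t.lift γ) (delta_lift_source γ)) := by
    funext γ
    rw [map_smul, smul_eq_mul, mul_comm]
    rfl
  rw [h2]
  exact h

lemma ext_coeff {S T : t.Op}
    (h : ∀ (x : UnitSpace G) τ (hτ : s (t.q τ) = (x : G)) σ, s (t.q σ) = (x : G) →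
      S.coeff x τ hτ σ = T.coeff x τ hτ σ) : S = T := by
  refine ext_at fun x => ContinuousLinearMap.ext fun ξ => ext_ev fun σ hσ => ?_
  refine (hasSum_ev S x ξ σ).unique ?_
  simp only [h x _ _ σ hσ]
  exact hasSum_ev T x ξ σ

/-- `T` has the kernel `(σ, τ) ↦ f (σ τ⁻¹)`. -/
def HasKernel (T : t.Op) (f : E → ℂ) : Prop :=
  ∀ (x : UnitSpace G) τ (hτ : s (t.q τ) = (x : G)) σ, s (t.q σ) = (x : G) →
    T.coeff x τ hτ σ = f (mul σ (inv τ))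

namespace HasKernel

variable {S T : t.Op} {f g : E → ℂ}

lemma unique (hS : S.HasKernel f) (hT : T.HasKernel f) : S = T :=
  ext_coeff fun x τ hτ σ hσ => by rw [hS x τ hτ σ hσ, hT x τ hτ σ hσ]

lemma add (hS : S.HasKernel f) (hT : T.HasKernel g) : (S + T).HasKernel (f + g) :=
  fun x τ hτ σ hσ => by rw [coeff_add, hS x τ hτ σ hσ, hT x τ hτ σ hσ]; rfl

lemma smul (c : ℂ) (hT : T.HasKernel f) : (c • T).HasKernel (c • f) :=
  fun x τ hτ σ hσ => by rw [coeff_smul, hT x τ hτ σ hσ]; rfl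

lemma zero : (0 : t.Op).HasKernel 0 := fun x τ hτ σ _ => by
  rw [coeff, at_zero, _root_.zero_apply, ev_zero]; rfl

lemma sum {ι : Type*} (I : Finset ι) {S : ι → t.Op} {f : ι → E → ℂ}
    (h : ∀ i ∈ I, (S i).HasKernel (f i)) : (∑ i ∈ I, S i).HasKernel (∑ i ∈ I, f i) := by
  classical
  induction I using Finset.induction_on with
  | empty => simpa using zero
  | insert i I hi ih =>
    rw [Finset.sum_insert hi, Finset.sum_insert hi]
    exact (h i (Finset.mem_insert_self i I)).add
      (ih fun j hj => h j (Finset.mem_insert_of_mem hj))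

lemma star (hT : T.HasKernel f) : (star T).HasKernel fun σ => conj (f (inv σ)) :=
  fun x τ hτ σ hσ => by
    have hs : s σ = s τ := t.s_eq_iff.2 (hσ.trans hτ.symm)
    change _ = conj (f (inv (mul σ (inv τ))))
    rw [coeff_star T x τ hτ σ hσ, hT x σ hσ τ hτ, inv_mul (by rw [hs, r_inv]),
      TopGroupoid.inv_inv]

lemma ev_hasSum (hT : T.HasKernel f) (x : UnitSpace G) (ξ : t.H x) (σ : E)
    (hσ : s (t.q σ) = (x : G)) :
    HasSum (fun γ : {γ : G // s γ = (x : G)} => f (mul σ (inv (t.lift γ))) * ξ.ev (t.lift γ))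
      ((T.at x ξ).ev σ) := by
  have h := hasSum_ev T x ξ σ
  simp only [hT x _ _ σ hσ] at h
  exact h

lemma isRegularRep (hT : T.HasKernel f) : t.IsRegularRep f T := by
  intro x ξ σ hσ
  rw [← ev_eq _ hσ, ← (hT.ev_hasSum x ξ σ hσ).tsum_eq]
  refine tsum_congr fun γ => ?_
  rw [val_apply ξ γ (t.q_lift _)]

end HasKernel

/-- A sum over an `s`-fibre reduced to its only nonzero term. -/
lemma hasSum_of_forall_ne {f g : E → ℂ} (hf : t.IsEquivariant f) (hg : t.IsEquivariant g)
    {x : UnitSpace G} {σ τ : E} (hσ : s (t.q σ) = (x : G)) (hτ : s (t.q τ) = (x : G))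
    (h : ∀ τ', s (t.q τ') = (x : G) → t.q τ' ≠ t.q τ → f (mul σ (inv τ')) * g τ' = 0) :
    HasSum (fun γ : {γ : G // s γ = (x : G)} => f (mul σ (inv (t.lift γ))) * g (t.lift γ))
      (f (mul σ (inv τ)) * g τ) := by
  rw [← hf.mul_inv_mul hg (t.s_eq_iff.2 (hσ.trans hτ.symm)) (t.q_lift (t.q τ))]
  refine hasSum_single (⟨t.q τ, hτ⟩ : {γ : G // s γ = (x : G)}) fun γ hγ => ?_
  refine h _ (delta_lift_source γ) fun h2 => hγ (Subtype.ext ?_)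
  rwa [q_lift] at h2

/-- Applied to a point mass, the sum defining `π_x(f)` keeps only the term over `t.q τ`;
equivariance replaces the chosen lift by `τ` itself. -/
lemma hasKernel_of_isRegularRep {f : E → ℂ} {T : t.Op} (hf : t.IsEquivariant f)
    (hT : t.IsRegularRep f T) : T.HasKernel f := by
  intro x τ hτ σ hσ
  rw [coeff, ev_eq _ hσ, hT x _ σ hσ]
  have h := hasSum_of_forall_ne (σ := σ) hf (isEquivariant_ev (delta x τ hτ)) hσ hτ
    fun τ' _ h => by rw [ev_delta_of_ne _ _ h, mul_zero]
  rw [ev_delta_self, mul_one] at h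
  rw [← h.tsum_eq]
  refine tsum_congr fun γ => ?_
  rw [val_apply _ γ (t.q_lift _)]

/-- The action on `H_x` of a kernel which is supported over a set on which `r` and `s` are
injective. -/
lemma exists_kernel_action {f : E → ℂ} (hf : t.IsEquivariant f) {U : Set G}
    (hr : Set.InjOn r U) (hs : Set.InjOn s U) (hU : ∀ σ, t.q σ ∉ U → f σ = 0)
    {M : ℝ} (hM : 0 ≤ M) (hfM : ∀ σ, ‖f σ‖ ≤ M) (x : UnitSpace G) :
    ∃ Φ : t.H x → t.H x, ∀ ξ, ‖Φ ξ‖ ≤ M * ‖ξ‖ ∧ ∀ σ, s (t.q σ) = (x : G) →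
      HasSum (fun γ : {γ : G // s γ = (x : G)} =>
        f (mul σ (inv (t.lift γ))) * ξ.ev (t.lift γ)) ((Φ ξ).ev σ) := by
  classical
  let F : t.H x → E → ℂ := fun ξ σ => ∑' γ : {γ : G // s γ = (x : G)},
    f (mul σ (inv (t.lift γ))) * ξ.ev (t.lift γ)
  -- two nonzero terms have the same index
  have h0 : ∀ σ τ, s (t.q σ) = (x : G) → s (t.q τ) = (x : G) → f (mul σ (inv τ)) ≠ 0 →
      mul (t.q σ) (inv (t.q τ)) ∈ U := by
    intro σ τ hσ hτ h
    rw [← t.q_mul_inv (hσ.trans hτ.symm)]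
    by_contra h2
    exact h (hU _ h2)
  have h1 : ∀ σ τ τ', s (t.q σ) = (x : G) → s (t.q τ) = (x : G) → s (t.q τ') = (x : G) →
      f (mul σ (inv τ)) ≠ 0 → f (mul σ (inv τ')) ≠ 0 → t.q τ' = t.q τ := by
    intro σ τ τ' hσ hτ hτ' h h'
    refine mul_inv_left_injective (hσ.trans hτ'.symm) (hσ.trans hτ.symm)
      (hr (h0 _ _ hσ hτ' h') (h0 _ _ hσ hτ h) ?_)
    rw [r_mul _ _ (by rw [hσ, r_inv, hτ']), r_mul _ _ (by rw [hσ, r_inv, hτ])]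
  -- Injectivity of `r` on `U` left at most one nonzero entry in each row; injectivity of `s` does
  -- the same for columns.
  have h2 : ∀ σ σ' τ, s (t.q σ) = (x : G) → s (t.q σ') = (x : G) → s (t.q τ) = (x : G) →
      f (mul σ (inv τ)) ≠ 0 → f (mul σ' (inv τ)) ≠ 0 → t.q σ = t.q σ' := by
    intro σ σ' τ hσ hσ' hτ h h'
    refine mul_inv_right_injective (hσ.trans hτ.symm) (hσ'.trans hτ.symm)
      (hs (h0 _ _ hσ hτ h) (h0 _ _ hσ' hτ h') ?_)
    rw [s_mul _ _ (by rw [hσ, r_inv, hτ]), s_mul _ _ (by rw [hσ', r_inv, hτ])]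
  have hsum : ∀ (ξ : t.H x) σ, s (t.q σ) = (x : G) →
      HasSum (fun γ : {γ : G // s γ = (x : G)} =>
        f (mul σ (inv (t.lift γ))) * ξ.ev (t.lift γ)) (F ξ σ) := by
    intro ξ σ hσ
    refine Summable.hasSum (summable_of_hasFiniteSupport (Set.Subsingleton.finite ?_))
    intro γ hγ γ' hγ'
    have h3 := h1 σ _ _ hσ (delta_lift_source γ) (delta_lift_source γ')
      (left_ne_zero_of_mul hγ) (left_ne_zero_of_mul hγ')
    rw [q_lift, q_lift] at h3
    exact Subtype.ext h3.symm
  have hsingle : ∀ (ξ : t.H x) σ τ, s (t.q σ) = (x : G) → s (t.q τ) = (x : G) →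
      f (mul σ (inv τ)) ≠ 0 → F ξ σ = f (mul σ (inv τ)) * ξ.ev τ := by
    intro ξ σ τ hσ hτ h
    refine (hsum ξ σ hσ).unique (hasSum_of_forall_ne hf ξ.isEquivariant_ev hσ hτ ?_)
    intro τ' hτ' hne
    by_contra h3
    exact hne (h1 σ τ τ' hσ hτ hτ' h (left_ne_zero_of_mul h3))
  have hF : ∀ (ξ : t.H x) (z : Circle) σ, s (t.q σ) = (x : G) →
      F ξ (t.act z σ) = F ξ σ * conj (z : ℂ) := by
    intro ξ z σ hσ
    simp only [F]
    rw [← tsum_mul_right]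
    refine tsum_congr fun γ => ?_
    have hc : s σ = r (inv (t.lift (γ : G))) := by
      rw [r_inv]; exact t.s_eq_iff.2 (hσ.trans (delta_lift_source γ).symm)
    rw [t.act_mul hc, hf]
    ring
  have hpart : ∀ (ξ : t.H x) σ, s (t.q σ) = (x : G) → F ξ σ ≠ 0 →
      ∃ γ : {γ : G // s γ = (x : G)}, f (mul σ (inv (t.lift γ))) ≠ 0 := by
    intro ξ σ hσ h
    by_contra! h3
    apply h
    simp only [F, h3, zero_mul, tsum_zero]
  let φ : t.H x → ∀ γ : {γ : G // s γ = (x : G)}, t.Fibre (γ : G) := fun ξ γ =>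
    Fibre.ofFun (γ : G) (F ξ) fun z σ hσ => hF ξ z σ (by rw [hσ]; exact γ.2)
  have hφ : ∀ ξ γ, ‖φ ξ γ‖ = ‖F ξ (t.lift γ)‖ := fun ξ γ => by
    rw [Fibre.norm_eq (φ ξ γ) (t.q_lift _), Fibre.ofFun_apply _ (t.q_lift _)]
  have hbound : ∀ ξ (I : Finset {γ : G // s γ = (x : G)}),
      ∑ γ ∈ I, ‖φ ξ γ‖ ^ (2 : ℝ≥0∞).toReal ≤ (M * ‖ξ‖) ^ (2 : ℝ≥0∞).toReal := by
    intro ξ I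
    -- `p` sends a row to the column of its nonzero entry; on rows where the result vanishes its
    -- value is irrelevant.
    have hex : ∀ γ : {γ : G // s γ = (x : G)}, ∃ γ' : {γ : G // s γ = (x : G)},
        F ξ (t.lift γ) ≠ 0 → f (mul (t.lift γ) (inv (t.lift γ'))) ≠ 0 := by
      intro γ
      by_cases h : F ξ (t.lift γ) = 0
      · exact ⟨γ, fun h' => absurd h h'⟩
      · obtain ⟨γ', h'⟩ := hpart ξ _ (delta_lift_source γ) h
        exact ⟨γ', fun _ => h'⟩
    choose p hp using hex
    let J : Finset {γ : G // s γ = (x : G)} := I.filter fun γ => F ξ (t.lift γ) ≠ 0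
    -- Columns have one nonzero entry, so no coordinate of `ξ` is used twice. Hence the squared norm
    -- of the result is at most `M ^ 2` times that of `ξ`.
    have hinj : Set.InjOn p J := by
      intro γ hγ γ' hγ' h
      have h3 := hp γ (Finset.mem_filter.1 hγ).2
      have h4 := hp γ' (Finset.mem_filter.1 hγ').2
      rw [← h] at h4
      have h5 := h2 _ _ _ (delta_lift_source γ) (delta_lift_source γ')
        (delta_lift_source (p γ)) h3 h4
      rw [q_lift, q_lift] at h5
      exact Subtype.ext h5
    simp only [ENNReal.toReal_ofNat, Real.rpow_ofNat]
    calc ∑ γ ∈ I, ‖φ ξ γ‖ ^ 2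
        = ∑ γ ∈ J, ‖φ ξ γ‖ ^ 2 := by
          refine (Finset.sum_filter_of_ne fun γ _ h => ?_).symm
          rintro h3
          rw [hφ, h3] at h
          simp at h
      _ ≤ ∑ γ ∈ J, M ^ 2 * ‖ξ.val (p γ)‖ ^ 2 := by
          refine Finset.sum_le_sum fun γ hγ => ?_
          rw [hφ, hsingle ξ _ _ (delta_lift_source γ) (delta_lift_source (p γ))
            (hp γ (Finset.mem_filter.1 hγ).2), norm_mul, mul_pow, norm_val]
          gcongr
          exact hfM _
      _ = M ^ 2 * ∑ γ ∈ J.image p,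
            ‖ξ.val γ‖ ^ 2 := by
          rw [Finset.sum_image hinj, Finset.mul_sum]
      _ ≤ M ^ 2 * ‖ξ‖ ^ 2 := by
          gcongr
          have h3 := lp.sum_rpow_le_norm_rpow
            (E := fun γ : {γ : G // s γ = (x : G)} => t.Fibre (γ : G)) (p := 2)
            (by norm_num) ξ (J.image p)
          simp only [ENNReal.toReal_ofNat, Real.rpow_ofNat] at h3
          exact h3
      _ = (M * ‖ξ‖) ^ 2 := by ring
  let Φ : t.H x → t.H x := fun ξ =>
    (⟨φ ξ, memℓp_gen' (hbound ξ)⟩ :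
      lp (fun γ : {γ : G // s γ = (x : G)} => t.Fibre (γ : G)) 2)
  have hΦ : ∀ ξ σ, s (t.q σ) = (x : G) → (Φ ξ).ev σ = F ξ σ := by
    intro ξ σ hσ
    rw [ev_eq _ hσ]
    exact Fibre.ofFun_apply (F := F ξ)
      (fun z σ' h' => hF ξ z σ' (by rw [h']; exact hσ)) rfl
  have hnorm : ∀ ξ, ‖Φ ξ‖ ≤ M * ‖ξ‖ := fun ξ =>
    lp.norm_le_of_forall_sum_le (E := fun γ : {γ : G // s γ = (x : G)} => t.Fibre (γ : G))
      (p := 2) (by norm_num) (by positivity) (hbound ξ)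
  exact ⟨Φ, fun ξ => ⟨hnorm ξ, fun σ hσ => (hΦ ξ σ hσ).symm ▸ hsum ξ σ hσ⟩⟩

/-- An equivariant function which is supported over a set on which `r` and `s` are injective
is the kernel of an operator. -/
theorem exists_hasKernel {f : E → ℂ} (hf : t.IsEquivariant f) {U : Set G}
    (hr : Set.InjOn r U) (hs : Set.InjOn s U) (hU : ∀ σ, t.q σ ∉ U → f σ = 0)
    {M : ℝ} (hM : 0 ≤ M) (hfM : ∀ σ, ‖f σ‖ ≤ M) : ∃ T : t.Op, T.HasKernel f ∧ ‖T‖ ≤ M := by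
  choose Φ hΦ using fun x => exists_kernel_action hf hr hs hU hM hfM x
  let L : ∀ x, t.H x →ₗ[ℂ] t.H x := fun x =>
    { toFun := Φ x
      map_add' := fun ξ η => ext_ev fun σ hσ => by
        rw [ev_add]
        refine ((hΦ x _).2 σ hσ).unique ?_
        simp only [ev_add, mul_add]
        exact ((hΦ x ξ).2 σ hσ).add ((hΦ x η).2 σ hσ)
      map_smul' := fun c ξ => ext_ev fun σ hσ => by
        rw [RingHom.id_apply, ev_smul]
        refine ((hΦ x _).2 σ hσ).unique ?_
        simp only [ev_smul, mul_left_comm _ c]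
        exact ((hΦ x ξ).2 σ hσ).mul_left c }
  let T : ∀ x, t.H x →L[ℂ] t.H x := fun x =>
    (L x).mkContinuous M fun ξ => (hΦ x ξ).1
  have hT : ∀ x, ‖T x‖ ≤ M := fun x => LinearMap.mkContinuous_norm_le _ hM _
  refine ⟨ofFamily T M hT, ?_, norm_le hM hT⟩
  intro x τ hτ σ hσ
  have h := hasSum_of_forall_ne (σ := σ) hf (isEquivariant_ev (delta x τ hτ)) hσ hτ
    fun τ' _ h => by rw [ev_delta_of_ne _ _ h, mul_zero]
  rw [ev_delta_self, mul_one] at h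
  exact ((hΦ x (delta x τ hτ)).2 σ hσ).unique h

end Op

end Twist

/-! ### Bisections of an étale groupoid. -/

section Etale

variable {G : Type*} [TopologicalSpace G] [TopGroupoid G]

lemma continuous_sourceMap : Continuous (sourceMap : G → UnitSpace G) :=
  continuous_s.subtype_mk _

lemma isClosed_unitSpace [T2Space G] : IsClosed {γ : G | r γ = γ} :=
  isClosed_eq continuous_r continuous_id

/-- An open set on which the range and source maps are injective. -/
structure IsBisection (U : Set G) : Prop where
  isOpen : IsOpen U
  injOn_r : Set.InjOn r U
  injOn_s : Set.InjOn s U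

namespace IsEtale

variable (hG : IsEtale G)
include hG

lemma exists_injOn_r (γ : G) : ∃ U : Set G, IsOpen U ∧ γ ∈ U ∧ Set.InjOn r U := by
  obtain ⟨e, he, h⟩ := hG γ
  refine ⟨e.source, e.open_source, he, fun a ha b hb hab => ?_⟩
  refine e.injOn ha hb ?_
  rw [← h]
  exact Subtype.ext hab

/-- Near a unit, `γ` and `r γ` both lie in a set on which `r` is injective, and they have the same
range. -/
lemma isOpen_unitSpace : IsOpen {γ : G | r γ = γ} := by
  rw [isOpen_iff_mem_nhds]
  intro x hx
  obtain ⟨U, hU, hxU, hinj⟩ := hG.exists_injOn_r x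
  have hxU' : r x ∈ U := by rw [hx]; exact hxU
  filter_upwards [hU.mem_nhds hxU, continuous_r.continuousAt (hU.mem_nhds hxU')] with γ h1 h2
  exact hinj h2 h1 (r_r γ)

/-- Inversion exchanges `r` and `s`, so injectivity of `s` near `γ` is injectivity of `r` near `inv
γ`. -/
lemma exists_isBisection (γ : G) : ∃ U : Set G, IsBisection U ∧ γ ∈ U := by
  obtain ⟨U, hU, hγU, hr⟩ := hG.exists_injOn_r γ
  obtain ⟨V, hV, hγV, hs⟩ := hG.exists_injOn_r (inv γ)
  refine ⟨U ∩ inv ⁻¹' V, ⟨hU.inter (hV.preimage TopGroupoid.continuous_inv),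
    hr.mono Set.inter_subset_left,
    fun a ha b hb hab => ?_⟩, hγU, hγV⟩
  have h := hs ha.2 hb.2 (by rw [r_inv, r_inv, hab])
  rw [← TopGroupoid.inv_inv a, h, TopGroupoid.inv_inv]

lemma isOpenMap_sourceMap : IsOpenMap (sourceMap : G → UnitSpace G) := by
  have h : (sourceMap : G → UnitSpace G) = rangeMap ∘ inv := by
    funext γ
    exact Subtype.ext (r_inv γ).symm
  have hinv : Function.Involutive (inv : G → G) := TopGroupoid.inv_inv
  rw [h]
  exact hG.isOpenMap.comp (Homeomorph.mk hinv.toPerm TopGroupoid.continuous_inv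
    TopGroupoid.continuous_inv).isOpenMap

/-- Arrows have small bisections around them, which consist of units or contain no units. -/
lemma exists_isBisection_unit_or_disjoint [T2Space G] (γ : G) :
    ∃ U : Set G, (IsBisection U ∧ ((∀ γ ∈ U, r γ = γ) ∨ ∀ γ ∈ U, r γ ≠ γ)) ∧ γ ∈ U := by
  obtain ⟨U, hU, hγ⟩ := hG.exists_isBisection γ
  by_cases h : r γ = γ
  · exact ⟨U ∩ {γ | r γ = γ}, ⟨⟨hU.isOpen.inter hG.isOpen_unitSpace,
      hU.injOn_r.mono Set.inter_subset_left, hU.injOn_s.mono Set.inter_subset_left⟩,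
      Or.inl fun _ h => h.2⟩, hγ, h⟩
  · exact ⟨U ∩ {γ | r γ = γ}ᶜ, ⟨⟨hU.isOpen.inter isClosed_unitSpace.isOpen_compl,
      hU.injOn_r.mono Set.inter_subset_left, hU.injOn_s.mono Set.inter_subset_left⟩,
      Or.inr fun _ h => h.2⟩, hγ, h⟩

end IsEtale

end Etale

/-! ### Compactly supported sections and their convolution. -/

namespace Twist

variable {G : Type*} {E : Type*} [TopologicalSpace G] [TopGroupoid G]
  [TopologicalSpace E] [TopGroupoid E] {t : Twist G E}

variable (t) in
/-- Continuous sections whose support is a compact subset of `U`. -/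
def IsCcOn (U : Set G) (f : E → ℂ) : Prop :=
  Continuous f ∧ t.IsEquivariant f ∧
    ∃ K : Set G, IsCompact K ∧ K ⊆ U ∧ ∀ σ, t.q σ ∉ K → f σ = 0

lemma IsCcOn.isCcSection {U : Set G} {f : E → ℂ} (hf : t.IsCcOn U f) : t.IsCcSection f := by
  obtain ⟨h1, h2, K, hK, -, h⟩ := hf
  exact ⟨h1, h2, K, hK, h⟩

lemma IsCcOn.eq_zero {U : Set G} {f : E → ℂ} (hf : t.IsCcOn U f) {σ : E} (h : t.q σ ∉ U) :
    f σ = 0 := by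
  obtain ⟨-, -, K, -, hKU, h2⟩ := hf
  exact h2 σ fun h3 => h (hKU h3)

namespace IsCcSection

variable {f g : E → ℂ}

/-- The section itself does not descend to `G`, but its modulus does, and it is continuous there
because `t.q` is a quotient map. -/
lemma exists_bound (hf : t.IsCcSection f) : ∃ M : ℝ, 0 ≤ M ∧ ∀ σ, ‖f σ‖ ≤ M := by
  obtain ⟨hc, he, K, hK, h0⟩ := hf
  have h1 : (fun γ => ‖f (t.lift γ)‖) ∘ t.q = fun σ => ‖f σ‖ :=
    funext fun σ => he.norm_eq (t.q_lift _)
  have h2 : Continuous fun γ => ‖f (t.lift γ)‖ := by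
    rw [← t.isOpenQuotientMap_q.continuous_comp_iff, h1]
    exact hc.norm
  obtain ⟨M, hM⟩ := hK.exists_bound_of_continuousOn h2.continuousOn
  refine ⟨max M 0, le_max_right _ _, fun σ => ?_⟩
  by_cases hσ : t.q σ ∈ K
  · have h3 := hM _ hσ
    rw [norm_norm, he.norm_eq (t.q_lift (t.q σ))] at h3
    exact h3.trans (le_max_left _ _)
  · rw [h0 σ hσ, norm_zero]
    exact le_max_right _ _

lemma zero : t.IsCcSection 0 :=
  ⟨continuous_const, fun _ _ => by simp, ∅, isCompact_empty, fun _ _ => rfl⟩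

lemma add (hf : t.IsCcSection f) (hg : t.IsCcSection g) : t.IsCcSection (f + g) := by
  obtain ⟨hf1, hf2, K, hK, hf3⟩ := hf
  obtain ⟨hg1, hg2, L, hL, hg3⟩ := hg
  refine ⟨hf1.add hg1, fun z σ => ?_, K ∪ L, hK.union hL, fun σ hσ => ?_⟩
  · rw [Pi.add_apply, Pi.add_apply, hf2, hg2, add_mul]
  · rw [Set.mem_union, not_or] at hσ
    rw [Pi.add_apply, hf3 σ hσ.1, hg3 σ hσ.2, add_zero]

lemma smul (c : ℂ) (hf : t.IsCcSection f) : t.IsCcSection (c • f) := by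
  obtain ⟨hf1, hf2, K, hK, hf3⟩ := hf
  refine ⟨hf1.const_smul c, fun z σ => ?_, K, hK, fun σ hσ => ?_⟩
  · rw [Pi.smul_apply, Pi.smul_apply, hf2, smul_mul_assoc]
  · rw [Pi.smul_apply, hf3 σ hσ, smul_zero]

lemma star (hf : t.IsCcSection f) : t.IsCcSection fun σ => conj (f (inv σ)) := by
  obtain ⟨hf1, hf2, K, hK, hf3⟩ := hf
  refine ⟨Complex.continuous_conj.comp (hf1.comp continuous_inv), fun z σ => ?_, inv '' K,
    hK.image continuous_inv, fun σ hσ => ?_⟩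
  · change conj (f (inv (t.act z σ))) = conj (f (inv σ)) * conj (z : ℂ)
    rw [inv_act, hf2, circle_inv, Complex.conj_conj, map_mul]
  · change conj (f (inv σ)) = 0
    rw [hf3, map_zero]
    rw [q_inv]
    exact fun h => hσ ⟨_, h, TopGroupoid.inv_inv _⟩

end IsCcSection

/-- Partition of a section into sections supported over bisections. -/
lemma IsCcSection.exists_sum [T2Space G] [LocallyCompactSpace G] (hG : IsEtale G) {f : E → ℂ}
    (hf : t.IsCcSection f) :
    ∃ (n : ℕ) (U : Fin n → Set G) (F : Fin n → E → ℂ), f = ∑ i, F i ∧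
      ∀ i, IsBisection (U i) ∧ ((∀ γ ∈ U i, r γ = γ) ∨ ∀ γ ∈ U i, r γ ≠ γ) ∧
        t.IsCcOn (U i) (F i) := by
  obtain ⟨hc, he, K, hK, h0⟩ := hf
  choose V hV hγV using hG.exists_isBisection_unit_or_disjoint
  obtain ⟨I, hI⟩ := hK.elim_finite_subcover V (fun γ => (hV γ).1.isOpen)
    fun γ _ => Set.mem_iUnion.2 ⟨γ, hγV γ⟩
  let U : Fin I.card → Set G := fun i => V (I.equivFin.symm i)
  have hKU : K ⊆ ⋃ i, U i := by
    intro γ hγ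
    obtain ⟨γ', h1, h2⟩ := Set.mem_iUnion₂.1 (hI hγ)
    refine Set.mem_iUnion.2 ⟨I.equivFin ⟨γ', h1⟩, ?_⟩
    simp only [U, Equiv.symm_apply_apply]
    exact h2
  obtain ⟨φ, hφ1, hφ2, -, hφ3⟩ := exists_continuous_sum_one_of_isOpen_isCompact
    (fun i => (hV (I.equivFin.symm i)).1.isOpen : ∀ i, IsOpen (U i)) hK hKU
  refine ⟨I.card, U, fun i σ => (φ i (t.q σ) : ℂ) * f σ, ?_, fun i =>
    ⟨(hV _).1, (hV _).2, ?_, fun z σ => ?_, tsupport (φ i), hφ3 i, hφ1 i, fun σ hσ => ?_⟩⟩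
  · funext σ
    rw [Finset.sum_apply, ← Finset.sum_mul]
    by_cases hσ : t.q σ ∈ K
    · have h := hφ2 hσ
      rw [Finset.sum_apply, Pi.one_apply] at h
      rw [← Complex.ofReal_sum, h, Complex.ofReal_one, one_mul]
    · rw [h0 σ hσ, mul_zero]
  · exact (Complex.continuous_ofReal.comp ((φ i).continuous.comp
      t.isOpenQuotientMap_q.continuous)).mul hc
  · change (φ i (t.q (t.act z σ)) : ℂ) * f (t.act z σ) = φ i (t.q σ) * f σ * conj (z : ℂ)
    rw [q_act, he, _root_.mul_assoc]
  · change (φ i (t.q σ) : ℂ) * f σ = 0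
    rw [image_eq_zero_of_notMem_tsupport hσ, Complex.ofReal_zero, zero_mul]

/-- The convolution of sections. -/
def convolution (t : Twist G E) (f g : E → ℂ) (σ : E) : ℂ :=
  ∑' γ : {γ : G // s γ = (sourceMap (t.q σ) : G)}, f (mul σ (inv (t.lift γ))) * g (t.lift γ)

section Convolution

variable {f g : E → ℂ} {U : Set G}

/-- Injectivity of `s` on `U` leaves a single arrow in the sum, and the term does not depend on the
point `τ` chosen above it. -/
lemma convolution_eq (hU : IsBisection U) (hf : t.IsEquivariant f) (hg : t.IsCcOn U g)
    {σ τ : E} (hτ : s (t.q τ) = s (t.q σ)) (hτU : t.q τ ∈ U) :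
    t.convolution f g σ = f (mul σ (inv τ)) * g τ := by
  refine (Op.hasSum_of_forall_ne (x := sourceMap (t.q σ)) hf hg.2.1 rfl hτ
    fun τ' hτ' hne => ?_).tsum_eq
  rw [hg.eq_zero, mul_zero]
  exact fun h => hne (hU.injOn_s h hτU (hτ'.trans hτ.symm))

lemma convolution_eq_zero {σ : E} (h : ∀ τ, s (t.q τ) = s (t.q σ) → g τ = 0) :
    t.convolution f g σ = 0 := by
  rw [convolution, ← tsum_zero (β := {γ : G // s γ = (sourceMap (t.q σ) : G)})]
  refine tsum_congr fun γ => ?_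
  rw [h _ (H.delta_lift_source γ), mul_zero]

lemma continuousOn_kernel (hf : Continuous f) (hg : Continuous g) :
    ContinuousOn (fun p : E × E => f (mul p.1 (inv p.2)) * g p.2)
      {p | s (t.q p.1) = s (t.q p.2)} := by
  refine ContinuousOn.mul ?_ (hg.comp continuous_snd).continuousOn
  refine hf.comp_continuousOn ?_
  refine continuousOn_mul.comp (f := fun p : E × E => (p.1, inv p.2))
    (continuous_fst.prodMk (TopGroupoid.continuous_inv.comp continuous_snd)).continuousOn ?_
  intro p hp
  change s p.1 = r (inv p.2)
  rw [r_inv]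
  exact t.s_eq_iff.2 hp

lemma isEquivariant_convolution (hU : IsBisection U) (hf : t.IsEquivariant f)
    (hg : t.IsCcOn U g) : t.IsEquivariant (t.convolution f g) := by
  intro z σ
  by_cases h : ∃ τ, s (t.q τ) = s (t.q σ) ∧ t.q τ ∈ U
  · obtain ⟨τ, h1, h2⟩ := h
    rw [convolution_eq hU hf hg h1 h2, convolution_eq hU hf hg (by rwa [q_act]) h2,
      t.act_mul (by rw [r_inv]; exact t.s_eq_iff.2 h1.symm), hf]
    ring
  · push Not at h
    rw [convolution_eq_zero, convolution_eq_zero, zero_mul]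
    · exact fun τ hτ => hg.eq_zero (h τ hτ)
    · exact fun τ hτ => hg.eq_zero (h τ (by rwa [q_act] at hτ))

lemma continuous_convolution [T2Space G] (hG : IsEtale G) (hU : IsBisection U)
    (hfc : Continuous f) (hf : t.IsEquivariant f) (hg : t.IsCcOn U g) :
    Continuous (t.convolution f g) := by
  rw [continuous_iff_continuousAt]
  intro σ
  have hq := t.isOpenQuotientMap_q
  by_cases h : ∃ γ ∈ U, s γ = s (t.q σ)
  · obtain ⟨γ, hγU, hγ⟩ := h
    obtain ⟨τ, rfl⟩ := hq.surjective γ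
    intro N hN
    rw [convolution_eq hU hf hg hγ hγU] at hN
    have h1 := continuousOn_kernel (t := t) hfc hg.1 (σ, τ) hγ.symm hN
    rw [Filter.mem_map, mem_nhdsWithin_iff_exists_mem_nhds_inter] at h1
    obtain ⟨W, hW, hWN⟩ := h1
    obtain ⟨A, hA, B, hB, hAB⟩ := mem_nhds_prod_iff.1 hW
    -- The source map and `t.q` are open, so every `σ'` near `σ` has a partner `τ'` over `U` close
    -- to `τ`. The single-term formula then gives continuity at `σ`.
    have hV : (fun τ => sourceMap (t.q τ)) '' (B ∩ t.q ⁻¹' U) ∈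
        nhds (sourceMap (t.q τ)) :=
      (hG.isOpenMap_sourceMap.comp hq.isOpenMap).image_mem_nhds (x := τ)
        (Filter.inter_mem hB ((hU.isOpen.preimage hq.continuous).mem_nhds hγU))
    have hV' : sourceMap (t.q τ) = sourceMap (t.q σ) := Subtype.ext hγ
    rw [hV'] at hV
    have hcont : ContinuousAt (fun σ => sourceMap (t.q σ)) σ :=
      (continuous_sourceMap.comp hq.continuous).continuousAt
    have hV2 := hcont hV
    rw [Filter.mem_map] at hV2 ⊢
    filter_upwards [hA, hV2] with σ' h1 h2
    obtain ⟨τ', ⟨h3, h4⟩, h5⟩ := h2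
    have h6 : s (t.q τ') = s (t.q σ') := congrArg Subtype.val h5
    rw [Set.mem_preimage, convolution_eq hU hf hg h6 h4]
    have h7 : (σ', τ') ∈ W ∩ {p : E × E | s (t.q p.1) = s (t.q p.2)} :=
      ⟨hAB (Set.mk_mem_prod h1 h3), h6.symm⟩
    exact hWN h7
  -- With no partner over `U`, the source of `σ` avoids the closed set `s '' K`, so the convolution
  -- vanishes in a neighbourhood of `σ`.
  · obtain ⟨-, -, K, hK, hKU, h0⟩ := hg
    have hcl : IsClosed (s '' K) := (hK.image continuous_s).isClosed
    have hσ : t.q σ ∈ s ⁻¹' (s '' K)ᶜ := by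
      rintro ⟨γ, hγ, h2⟩
      exact h ⟨γ, hKU hγ, h2⟩
    have hmem : ∀ᶠ σ' in nhds σ, t.q σ' ∈ s ⁻¹' (s '' K)ᶜ :=
      ((hcl.isOpen_compl.preimage continuous_s).preimage hq.continuous).mem_nhds hσ
    refine (continuousAt_const (y := (0 : ℂ))).congr ?_
    filter_upwards [hmem] with σ' h'
    symm
    refine convolution_eq_zero fun τ hτ => h0 τ fun h3 => h' ⟨_, h3, hτ⟩

/-- The support lies over the product of the two compact supports. Composable pairs form a closed
set since `G` is Hausdorff, so this product is compact. -/
lemma isCcSection_convolution [T2Space G] (hG : IsEtale G) (hU : IsBisection U)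
    (hf : t.IsCcSection f) (hg : t.IsCcOn U g) : t.IsCcSection (t.convolution f g) := by
  refine ⟨continuous_convolution hG hU hf.1 hf.2.1 hg, isEquivariant_convolution hU hf.2.1 hg, ?_⟩
  obtain ⟨-, hfe, K, hK, hf0⟩ := hf
  have hg' := hg
  obtain ⟨-, -, L, hL, hLU, hg0⟩ := hg
  have hcl : IsClosed {p : G × G | s p.1 = r p.2} :=
    isClosed_eq (continuous_s.comp continuous_fst) (continuous_r.comp continuous_snd)
  refine ⟨(fun p : G × G => mul p.1 p.2) '' ((K ×ˢ L) ∩ {p : G × G | s p.1 = r p.2}),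
    ((hK.prod hL).inter_right hcl).image_of_continuousOn
      (continuousOn_mul.mono Set.inter_subset_right), fun σ hσ => ?_⟩
  by_contra h
  have h1 : ∃ τ, s (t.q τ) = s (t.q σ) ∧ g τ ≠ 0 := by
    by_contra! h1
    exact h (convolution_eq_zero h1)
  obtain ⟨τ, h2, h3⟩ := h1
  have hτL : t.q τ ∈ L := by
    by_contra h4
    exact h3 (hg0 τ h4)
  rw [convolution_eq hU hfe hg' h2 (hLU hτL)] at h
  have h5 : t.q (mul σ (inv τ)) ∈ K := by
    by_contra h4
    exact h (by rw [hf0 _ h4, zero_mul])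
  rw [t.q_mul_inv h2.symm] at h5
  refine hσ ⟨(mul (t.q σ) (inv (t.q τ)), t.q τ), ⟨⟨h5, hτL⟩, ?_⟩, mul_inv_mul_cancel h2.symm⟩
  change s (mul _ _) = _
  rw [s_mul _ _ (by rw [r_inv, h2]), s_inv]

/-- The product of operators corresponds to the convolution of kernels. -/
lemma Op.HasKernel.mul_convolution {S T : t.Op} (hU : IsBisection U) (hf : t.IsEquivariant f)
    (hg : t.IsCcOn U g) (hT : T.HasKernel f) (hS : S.HasKernel g) :
    (T * S).HasKernel (t.convolution f g) := by
  intro x τ hτ σ hσ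
  have hs : s σ = s τ := t.s_eq_iff.2 (hσ.trans hτ.symm)
  have hc : s σ = r (inv τ) := by rw [hs, r_inv]
  have hsum := hT.ev_hasSum x (S.at x (H.delta x τ hτ)) σ hσ
  have hSτ : ∀ ρ, s (t.q ρ) = (x : G) →
      (S.at x (H.delta x τ hτ)).ev ρ = g (mul ρ (inv τ)) := fun ρ hρ => hS x τ hτ ρ hρ
  change ((T.at x (S.at x (H.delta x τ hτ))).ev σ) = _
  have hsrc : s (t.q (mul σ (inv τ))) = r (t.q τ) := by
    rw [t.q_mul_inv (hσ.trans hτ.symm), s_mul _ _ (by rw [r_inv, hσ, hτ]), s_inv]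
  by_cases h : ∃ ρ, s (t.q ρ) = r (t.q τ) ∧ t.q ρ ∈ U
  · obtain ⟨ρ, h1, h2⟩ := h
    have hρτ : s ρ = r τ := t.s_eq_r_iff.2 h1
    rw [convolution_eq hU hf hg (h1.trans hsrc.symm) h2]
    have hx : s (t.q (mul ρ τ)) = (x : G) := by
      rw [t.q_mul _ _ hρτ, s_mul _ _ h1, hτ]
    -- In the matrix product the term at `τ'` contains `g (τ' τ⁻¹)`. It vanishes unless `τ' τ⁻¹` is
    -- the arrow of `U` below `ρ`, that is, unless `τ'` lies over the same arrow as `ρ τ`.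
    have h3 := Op.hasSum_of_forall_ne (τ := mul ρ τ) hf
      (H.isEquivariant_ev (S.at x (H.delta x τ hτ))) hσ hx fun τ' hτ' hne => by
        rw [hSτ _ hτ', hg.eq_zero, mul_zero]
        intro h4
        apply hne
        rw [t.q_mul_inv (hτ'.trans hτ.symm)] at h4
        have h5 := hU.injOn_s h4 h2 (by
          rw [s_mul _ _ (by rw [r_inv, hτ', hτ]), s_inv, h1])
        rw [t.q_mul _ _ hρτ, ← h5, mul_inv_mul_cancel (hτ'.trans hτ.symm)]
    rw [hsum.unique h3, hSτ _ hx, mul_mul_inv_cancel hρτ, inv_mul hρτ,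
      TopGroupoid.mul_assoc _ _ _ hc (by rw [s_inv, r_inv, hρτ])]
  · push Not at h
    rw [convolution_eq_zero]
    · refine hsum.unique ?_
      convert hasSum_zero using 2 with γ
      rw [hSτ _ (H.delta_lift_source γ), hg.eq_zero, mul_zero]
      refine h _ ?_
      rw [t.q_mul_inv ((H.delta_lift_source γ).trans hτ.symm), s_mul _ _ (by
        rw [r_inv, H.delta_lift_source γ, hτ]), s_inv]
    · exact fun ρ hρ => hg.eq_zero (h ρ (hρ.trans hsrc))

end Convolution

lemma IsCcSection.sum {ι : Type*} (I : Finset ι) {F : ι → E → ℂ}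
    (h : ∀ i ∈ I, t.IsCcSection (F i)) : t.IsCcSection (∑ i ∈ I, F i) := by
  classical
  induction I using Finset.induction_on with
  | empty => simpa using IsCcSection.zero
  | insert i I hi ih =>
    rw [Finset.sum_insert hi]
    exact (h i (Finset.mem_insert_self i I)).add
      (ih fun j hj => h j (Finset.mem_insert_of_mem hj))

lemma IsCcOn.exists_hasKernel {U : Set G} (hU : IsBisection U) {f : E → ℂ} (hf : t.IsCcOn U f) :
    ∃ T : t.Op, T.HasKernel f := by
  obtain ⟨M, hM, h⟩ := hf.isCcSection.exists_bound
  obtain ⟨T, hT, -⟩ := Op.exists_hasKernel hf.2.1 hU.injOn_r hU.injOn_s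
    (fun σ hσ => hf.eq_zero hσ) hM h
  exact ⟨T, hT⟩

lemma exists_toOp_eq {T : t.Op} {f : E → ℂ} (hf : t.IsCcSection f) (hT : T.HasKernel f) :
    ∃ a : t.CStarRed, a.toOp = T := by
  refine ⟨⟨T, ?_⟩, rfl⟩
  exact NonUnitalStarSubalgebra.le_topologicalClosure _
    (NonUnitalStarAlgebra.subset_adjoin ℂ _ ⟨f, hf, hT.isRegularRep⟩)

namespace CStarRed

lemma ext_toOp {a b : t.CStarRed} (h : a.toOp = b.toOp) : a = b := Subtype.ext h

lemma toOp_add (a b : t.CStarRed) : (a + b).toOp = a.toOp + b.toOp := rfl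

lemma toOp_smul (c : ℂ) (a : t.CStarRed) : (c • a).toOp = c • a.toOp := rfl

lemma toOp_mul (a b : t.CStarRed) : (a * b).toOp = a.toOp * b.toOp := rfl

lemma toOp_star (a : t.CStarRed) : (star a).toOp = star a.toOp := rfl

lemma toOp_zero : (0 : t.CStarRed).toOp = 0 := rfl

end CStarRed

lemma source_i_one (x : UnitSpace G) : s (t.q (t.i (1, x))) = (x : G) := by
  rw [q_i, source_unit]

lemma toSection_eq_coeff (a : t.CStarRed) (σ : E) :
    toSection a σ = a.toOp.coeff (sourceMap (t.q σ)) (t.i (1, sourceMap (t.q σ)))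
      (source_i_one _) σ := by
  rw [toSection, H.unitVector_eq_delta, Op.coeff, H.ev_eq]
  rfl

lemma mul_inv_i_one (σ : E) : mul σ (inv (t.i (1, sourceMap (t.q σ)))) = σ := by
  rw [inv_i_one, ← t.s_eq, mul_s_self]

lemma toSection_of_hasKernel {a : t.CStarRed} {f : E → ℂ} (h : a.toOp.HasKernel f) (σ : E) :
    toSection a σ = f σ := by
  rw [toSection_eq_coeff, h _ _ _ σ rfl, mul_inv_i_one]

lemma restrict_of_hasKernel {a : t.CStarRed} {f : E → ℂ} (h : a.toOp.HasKernel f)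
    (x : UnitSpace G) : restrict a x = f (t.i (1, x)) := toSection_of_hasKernel h _

lemma IsCcSection.continuous_restrict {f : E → ℂ} (hf : t.IsCcSection f) :
    Continuous fun x : UnitSpace G => f (t.i (1, x)) :=
  hf.1.comp (t.isEmbedding_i.continuous.comp (by fun_prop))

lemma IsCcSection.exists_isCompact [T2Space G] {f : E → ℂ} (hf : t.IsCcSection f) :
    ∃ K : Set (UnitSpace G), IsCompact K ∧ ∀ x ∉ K, f (t.i (1, x)) = 0 := by
  obtain ⟨-, -, K, hK, h0⟩ := hf
  refine ⟨Subtype.val ⁻¹' K, ?_, fun x hx => h0 _ (by rwa [q_i])⟩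
  exact (isClosed_unitSpace (G := G)).isClosedEmbedding_subtypeVal.isCompact_preimage hK

/-! ### The dense ⋆-algebra of the operators `π(f)` and restriction to the unit space. -/

section Regular

variable [T2Space G] [LocallyCompactSpace G]

lemma IsCcSection.exists_hasKernel (hG : IsEtale G) {f : E → ℂ} (hf : t.IsCcSection f) :
    ∃ T : t.Op, T.HasKernel f := by
  obtain ⟨n, U, F, rfl, hF⟩ := hf.exists_sum hG
  choose T hT using fun i => (hF i).2.2.exists_hasKernel (hF i).1
  exact ⟨∑ i, T i, Op.HasKernel.sum _ fun i _ => hT i⟩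

variable (t) in
/-- The ⋆-algebra of the operators `π(f)`, `f ∈ C_c(G, E)`. -/
def regularAlgebra (hG : IsEtale G) : NonUnitalStarSubalgebra ℂ t.Op where
  carrier := {T : t.Op | ∃ f : E → ℂ, t.IsCcSection f ∧ T.HasKernel f}
  add_mem' := by
    rintro S T ⟨f, hf, hS⟩ ⟨g, hg, hT⟩
    exact ⟨f + g, hf.add hg, hS.add hT⟩
  zero_mem' := ⟨0, .zero, .zero⟩
  smul_mem' := by
    rintro c T ⟨f, hf, hT⟩
    exact ⟨c • f, hf.smul c, hT.smul c⟩
  star_mem' := by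
    rintro T ⟨f, hf, hT⟩
    exact ⟨_, hf.star, hT.star⟩
  mul_mem' := by
    rintro T S ⟨f, hf, hT⟩ ⟨g, hg, hS⟩
    obtain ⟨n, U, F, rfl, hF⟩ := hg.exists_sum hG
    choose R hR using fun i => (hF i).2.2.exists_hasKernel (hF i).1
    refine ⟨∑ i, t.convolution f (F i), IsCcSection.sum _ fun i _ =>
      isCcSection_convolution hG (hF i).1 hf (hF i).2.2, ?_⟩
    rw [hS.unique (Op.HasKernel.sum _ fun i _ => hR i), Finset.mul_sum]
    exact Op.HasKernel.sum _ fun i _ => (hT.mul_convolution (hF i).1 hf.2.1 (hF i).2.2 (hR i))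

/-- The operators `π(f)` already form a ⋆-algebra, so elements of `A` are norm limits of single
`π(f)`, not of polynomials in them. -/
lemma reducedCStarAlgebra_eq (hG : IsEtale G) :
    t.reducedCStarAlgebra = (t.regularAlgebra hG).topologicalClosure := by
  have h : {T : t.Op | ∃ f : E → ℂ, t.IsCcSection f ∧ t.IsRegularRep f T} =
      t.regularAlgebra hG := by
    ext T
    constructor
    · rintro ⟨f, hf, hT⟩
      exact ⟨f, hf, Op.hasKernel_of_isRegularRep hf.2.1 hT⟩
    · rintro ⟨f, hf, hT⟩
      exact ⟨f, hf, hT.isRegularRep⟩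
  rw [reducedCStarAlgebra, h, NonUnitalStarAlgebra.adjoin_eq]

lemma mem_reducedCStarAlgebra (hG : IsEtale G) {T : t.Op} :
    T ∈ t.reducedCStarAlgebra ↔ T ∈ closure (t.regularAlgebra hG : Set t.Op) := by
  rw [reducedCStarAlgebra_eq hG]
  rfl

namespace CStarRed

lemma exists_approx (hG : IsEtale G) (a : t.CStarRed) {ε : ℝ} (hε : 0 < ε) :
    ∃ b : t.CStarRed, ‖a - b‖ < ε ∧ ∃ f, t.IsCcSection f ∧ b.toOp.HasKernel f := by
  have h : a.toOp ∈ closure (t.regularAlgebra hG : Set t.Op) :=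
    (mem_reducedCStarAlgebra hG).1 a.2
  obtain ⟨T, ⟨f, hf, hT⟩, hd⟩ := Metric.mem_closure_iff.1 h ε hε
  obtain ⟨b, rfl⟩ := exists_toOp_eq hf hT
  rw [dist_eq_norm] at hd
  exact ⟨b, hd, f, hf, hT⟩

end CStarRed

/-- Every element of the reduced C⋆-algebra has the associated section as its kernel. -/
lemma hasKernel_toSection (hG : IsEtale G) (a : t.CStarRed) :
    a.toOp.HasKernel (toSection a) := by
  intro x τ hτ σ hσ
  rw [toSection_eq_coeff]
  have h : a.toOp ∈ closure (t.regularAlgebra hG : Set t.Op) :=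
    (mem_reducedCStarAlgebra hG).1 a.2
  -- Equality of two matrix entries is a closed condition on the operator, and for `π(f)` both
  -- entries equal `f (σ τ⁻¹)`.
  refine closure_minimal (s := (t.regularAlgebra hG : Set t.Op))
    (t := {T : t.Op | T.coeff x τ hτ σ = T.coeff (sourceMap (t.q (mul σ (inv τ))))
      (t.i (1, sourceMap (t.q (mul σ (inv τ))))) (source_i_one _) (mul σ (inv τ))}) ?_
    (isClosed_eq (Op.continuous_coeff _ _ _ _) (Op.continuous_coeff _ _ _ _)) h
  rintro T ⟨f, -, hT⟩
  change T.coeff _ _ _ _ = T.coeff _ _ _ _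
  rw [hT x τ hτ σ hσ, hT _ _ _ _ rfl, mul_inv_i_one]

lemma restrict_eq_coeff (hG : IsEtale G) (a : t.CStarRed) (x : UnitSpace G) :
    restrict a x = a.toOp.coeff x (t.i (1, x)) (source_i_one x) (t.i (1, x)) := by
  rw [hasKernel_toSection hG a _ _ _ _ (source_i_one x), mul_inv_self, t.r_i]
  rfl

lemma restrict_add (hG : IsEtale G) (a b : t.CStarRed) (x : UnitSpace G) :
    restrict (a + b) x = restrict a x + restrict b x := by
  simp only [restrict_eq_coeff hG, CStarRed.toOp_add, Op.coeff_add]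

lemma restrict_smul (hG : IsEtale G) (c : ℂ) (a : t.CStarRed) (x : UnitSpace G) :
    restrict (c • a) x = c * restrict a x := by
  simp only [restrict_eq_coeff hG, CStarRed.toOp_smul, Op.coeff_smul]

lemma norm_restrict_le (hG : IsEtale G) (a : t.CStarRed) (x : UnitSpace G) :
    ‖restrict a x‖ ≤ ‖a‖ := by
  rw [restrict_eq_coeff hG]
  exact Op.norm_coeff_le _ _ _ _ _

lemma restrict_sub (hG : IsEtale G) (a b : t.CStarRed) (x : UnitSpace G) :
    restrict (a - b) x = restrict a x - restrict b x := by
  rw [eq_sub_iff_add_eq, ← restrict_add hG, sub_add_cancel]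

/-- `restrict` is contractive into the supremum norm, so this is a uniform limit of restrictions of
`C_c` sections. -/
lemma continuous_restrict (hG : IsEtale G) (a : t.CStarRed) : Continuous (restrict a) := by
  refine continuous_of_uniform_approx_of_continuous fun u hu => ?_
  obtain ⟨ε, hε, hu⟩ := Metric.mem_uniformity_dist.1 hu
  obtain ⟨b, hab, f, hf, hb⟩ := a.exists_approx hG hε
  refine ⟨restrict b, ?_, fun x => hu ?_⟩
  · rw [funext (restrict_of_hasKernel hb)]
    exact hf.continuous_restrict
  · rw [dist_eq_norm, ← restrict_sub hG]
    exact (norm_restrict_le hG _ x).trans_lt hab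

lemma tendsto_restrict (hG : IsEtale G) (a : t.CStarRed) :
    Filter.Tendsto (restrict a) (Filter.cocompact _) (nhds 0) := by
  rw [Metric.tendsto_nhds]
  intro ε hε
  obtain ⟨b, hab, f, hf, hb⟩ := a.exists_approx hG hε
  obtain ⟨K, hK, h0⟩ := hf.exists_isCompact
  filter_upwards [hK.compl_mem_cocompact] with x hx
  have h1 : restrict b x = 0 := by rw [restrict_of_hasKernel hb, h0 x hx]
  have h2 := norm_restrict_le hG (a - b) x
  rw [restrict_sub hG, h1] at h2
  rw [dist_eq_norm]
  exact h2.trans_lt hab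

variable (t) in
/-- Restriction to the unit space. -/
def expectation (hG : IsEtale G) : t.CStarRed →ₗ[ℂ] C₀(UnitSpace G, ℂ) where
  toFun a := ⟨⟨restrict a, continuous_restrict hG a⟩, tendsto_restrict hG a⟩
  map_add' a b := ZeroAtInftyContinuousMap.ext (restrict_add hG a b)
  map_smul' c a := ZeroAtInftyContinuousMap.ext (restrict_smul hG c a)

lemma expectation_apply (hG : IsEtale G) (a : t.CStarRed) (x : UnitSpace G) :
    t.expectation hG a x = restrict a x := rfl

end Regular

/-! ### Functions on the unit space as sections and as diagonal operators. -/

variable (t) in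
/-- The section of `L` supported on the unit space which is defined by a function there. -/
def unitKernel (h : UnitSpace G → ℂ) (σ : E) : ℂ :=
  h (rangeMap (t.q σ)) * t.unitFun (rangeMap (t.q σ)) σ

section UnitKernel

variable (h : UnitSpace G → ℂ)

lemma unitKernel_of_ne {σ : E} (hσ : r (t.q σ) ≠ t.q σ) : t.unitKernel h σ = 0 := by
  rw [unitKernel, unitFun_of_q_ne _ _ (Ne.symm hσ), mul_zero]

lemma unitKernel_i (z : Circle) (x : UnitSpace G) :
    t.unitKernel h (t.i (z, x)) = h x * conj (z : ℂ) := by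
  rw [unitKernel, rangeMap_q_i, unitFun_i]

lemma isEquivariant_unitKernel : t.IsEquivariant (t.unitKernel h) := by
  intro z σ
  rw [unitKernel, unitKernel, q_act]
  have h1 : t.unitFun (rangeMap (t.q σ)) (t.act z σ) =
      t.unitFun (rangeMap (t.q σ)) σ * conj (z : ℂ) := (t.unitFibre (rangeMap (t.q σ))).2.1 z σ
  rw [h1, _root_.mul_assoc]

lemma norm_unitKernel_le {M : ℝ} (hM : 0 ≤ M) (hh : ∀ x, ‖h x‖ ≤ M) (σ : E) :
    ‖t.unitKernel h σ‖ ≤ M := by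
  by_cases hσ : r (t.q σ) = t.q σ
  · obtain ⟨z, x, rfl⟩ := t.exact σ hσ
    rw [unitKernel_i, norm_mul, RCLike.norm_conj, Circle.norm_coe, mul_one]
    exact hh x
  · rw [unitKernel_of_ne h hσ, norm_zero]
    exact hM

lemma eq_unitKernel {f : E → ℂ} (hf : t.IsEquivariant f) (h0 : ∀ σ, r (t.q σ) ≠ t.q σ → f σ = 0) :
    f = t.unitKernel fun x => f (t.i (1, x)) := by
  funext σ
  by_cases hσ : r (t.q σ) = t.q σ
  · obtain ⟨z, x, rfl⟩ := t.exact σ hσ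
    rw [unitKernel_i, ← hf, act_i, mul_one]
  · rw [unitKernel_of_ne _ hσ, h0 σ hσ]

lemma range_i : Set.range t.i = t.q ⁻¹' {γ : G | r γ = γ} := by
  ext σ
  constructor
  · rintro ⟨⟨z, x⟩, rfl⟩
    change r (t.q _) = t.q _
    rw [q_i, x.2]
  · intro hσ
    obtain ⟨z, x, rfl⟩ := t.exact σ hσ
    exact ⟨_, rfl⟩

variable {h}

/-- The unit space is open because `G` is étale and closed because `G` is Hausdorff, so extension by
zero off `𝕋 × G⁽⁰⁾` stays continuous. -/
lemma isCcSection_unitKernel [T2Space G] (hG : IsEtale G) (hc : Continuous h)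
    (hs : HasCompactSupport h) : t.IsCcSection (t.unitKernel h) := by
  have hq := t.isOpenQuotientMap_q.continuous
  have hi : Topology.IsOpenEmbedding t.i :=
    ⟨t.isEmbedding_i, by rw [range_i]; exact hG.isOpen_unitSpace.preimage hq⟩
  refine ⟨?_, isEquivariant_unitKernel h, Subtype.val '' tsupport h,
    hs.isCompact.image continuous_subtype_val, fun σ hσ => ?_⟩
  · rw [continuous_iff_continuousAt]
    intro σ
    by_cases hσ : r (t.q σ) = t.q σ
    · obtain ⟨z, x, rfl⟩ := t.exact σ hσ
      rw [← hi.continuousAt_iff]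
      have h1 : t.unitKernel h ∘ t.i = fun p => h p.2 * conj (p.1 : ℂ) :=
        funext fun p => unitKernel_i h p.1 p.2
      rw [h1]
      exact ((hc.comp continuous_snd).mul (Complex.continuous_conj.comp
        (continuous_subtype_val.comp continuous_fst))).continuousAt
    · have h1 : ∀ᶠ σ' in nhds σ, σ' ∈ t.q ⁻¹' {γ : G | r γ = γ}ᶜ :=
        ((isClosed_unitSpace (G := G)).isOpen_compl.preimage hq).mem_nhds hσ
      refine (continuousAt_const (y := (0 : ℂ))).congr ?_
      filter_upwards [h1] with σ' h2
      rw [unitKernel_of_ne h h2]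
  · by_cases h1 : r (t.q σ) = t.q σ
    · rw [unitKernel, image_eq_zero_of_notMem_tsupport (f := h), zero_mul]
      exact fun h2 => hσ ⟨_, h2, h1⟩
    · exact unitKernel_of_ne h h1

end UnitKernel

/-- `r` and `s` are the identity on units, so the unit space can play the role of the bisection in
`Op.exists_hasKernel`. -/
lemma exists_hasKernel_unitKernel (h : C₀(UnitSpace G, ℂ)) :
    ∃ T : t.Op, T.HasKernel (t.unitKernel h) ∧ ‖T‖ ≤ ‖h‖ := by
  refine Op.exists_hasKernel (U := {γ : G | r γ = γ}) (isEquivariant_unitKernel h) ?_ ?_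
    (fun σ hσ => unitKernel_of_ne h hσ) (norm_nonneg h)
    (norm_unitKernel_le h (norm_nonneg h) fun x => h.toBCF.norm_coe_le_norm x)
  · intro a ha b hb hab
    rwa [ha, hb] at hab
  · intro a ha b hb hab
    rwa [s_eq_of_unit ha, s_eq_of_unit hb] at hab

variable (t) in
/-- The operator of pointwise multiplication by `h ∘ r`. -/
def diagonal (h : C₀(UnitSpace G, ℂ)) : t.Op := (exists_hasKernel_unitKernel h).choose

section Diagonal

variable (h k : C₀(UnitSpace G, ℂ))

lemma hasKernel_diagonal : (t.diagonal h).HasKernel (t.unitKernel h) :=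
  (exists_hasKernel_unitKernel h).choose_spec.1

lemma norm_diagonal_le : ‖t.diagonal h‖ ≤ ‖h‖ := (exists_hasKernel_unitKernel h).choose_spec.2

/-- The kernel at `(σ, τ')` is nonzero only if `σ τ'⁻¹` lies over a unit, which forces `σ` and `τ'`
over the same arrow. -/
lemma diagonal_ev {x : UnitSpace G} (ξ : t.H x) {σ : E} (hσ : s (t.q σ) = (x : G)) :
    ((t.diagonal h).at x ξ).ev σ = h (rangeMap (t.q σ)) * ξ.ev σ := by
  have h1 := (hasKernel_diagonal h).ev_hasSum x ξ σ hσ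
  have h2 := Op.hasSum_of_forall_ne (τ := σ) (isEquivariant_unitKernel h) ξ.isEquivariant_ev
    hσ hσ fun τ' hτ' hne => by
      rw [unitKernel_of_ne, zero_mul]
      intro h3
      rw [t.q_mul_inv (hσ.trans hτ'.symm)] at h3
      exact hne (mul_inv_eq_unit (hσ.trans hτ'.symm) h3).symm
  rw [h1.unique h2, mul_inv_self, t.r_eq, unitKernel_i]
  simp

lemma diagonal_delta {x : UnitSpace G} (τ : E) (hτ : s (t.q τ) = (x : G)) :
    (t.diagonal h).at x (H.delta x τ hτ) = h (rangeMap (t.q τ)) • H.delta x τ hτ := by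
  refine H.ext_ev fun σ hσ => ?_
  rw [diagonal_ev h _ hσ, H.ev_smul]
  by_cases h1 : t.q σ = t.q τ
  · rw [h1]
  · rw [H.ev_delta_of_ne τ hτ h1, mul_zero, mul_zero]

lemma diagonal_coeff {x : UnitSpace G} (τ : E) (hτ : s (t.q τ) = (x : G)) (σ : E) :
    (t.diagonal h).coeff x τ hτ σ = h (rangeMap (t.q τ)) * (H.delta x τ hτ).ev σ := by
  rw [Op.coeff, diagonal_delta, H.ev_smul]

lemma diagonal_mul_coeff (T : t.Op) {x : UnitSpace G} (τ : E) (hτ : s (t.q τ) = (x : G)) {σ : E}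
    (hσ : s (t.q σ) = (x : G)) :
    (t.diagonal h * T).coeff x τ hτ σ = h (rangeMap (t.q σ)) * T.coeff x τ hτ σ :=
  diagonal_ev h _ hσ

lemma mul_diagonal_coeff (T : t.Op) {x : UnitSpace G} (τ : E) (hτ : s (t.q τ) = (x : G)) (σ : E) :
    (T * t.diagonal h).coeff x τ hτ σ = T.coeff x τ hτ σ * h (rangeMap (t.q τ)) := by
  rw [Op.coeff, Op.at_mul, diagonal_delta, map_smul, H.ev_smul, mul_comm]
  rfl

lemma diagonal_add : t.diagonal (h + k) = t.diagonal h + t.diagonal k := by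
  refine Op.ext_coeff fun x τ hτ σ hσ => ?_
  rw [Op.coeff_add, diagonal_coeff, diagonal_coeff, diagonal_coeff,
    ZeroAtInftyContinuousMap.add_apply, add_mul]

lemma diagonal_smul (c : ℂ) : t.diagonal (c • h) = c • t.diagonal h := by
  refine Op.ext_coeff fun x τ hτ σ hσ => ?_
  rw [Op.coeff_smul, diagonal_coeff, diagonal_coeff, ZeroAtInftyContinuousMap.smul_apply,
    smul_eq_mul, _root_.mul_assoc]

lemma diagonal_mul : t.diagonal (h * k) = t.diagonal h * t.diagonal k := by
  refine Op.ext_coeff fun x τ hτ σ hσ => ?_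
  rw [mul_diagonal_coeff, diagonal_coeff, diagonal_coeff, ZeroAtInftyContinuousMap.mul_apply]
  ring

lemma diagonal_star : t.diagonal (star h) = star (t.diagonal h) := by
  refine Op.ext_coeff fun x τ hτ σ hσ => ?_
  rw [Op.coeff_star _ _ _ _ _ hσ, diagonal_coeff, diagonal_coeff,
    ZeroAtInftyContinuousMap.star_apply, map_mul, ← H.inner_delta τ hτ, inner_conj_symm,
    H.inner_delta]
  by_cases h1 : t.q σ = t.q τ
  · rw [h1]; rfl
  · rw [H.ev_delta_of_ne τ hτ h1, mul_zero, mul_zero]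

lemma diagonal_sub : t.diagonal (h - k) = t.diagonal h - t.diagonal k := by
  rw [eq_sub_iff_add_eq, ← diagonal_add, sub_add_cancel]

end Diagonal

/-- Compactly supported functions are dense in the functions vanishing at infinity. -/
lemma _root_.ZeroAtInftyContinuousMap.exists_hasCompactSupport_norm_sub_le {X : Type*}
    [TopologicalSpace X] [T2Space X] [LocallyCompactSpace X] (h : C₀(X, ℂ)) {ε : ℝ}
    (hε : 0 < ε) : ∃ k : C₀(X, ℂ), HasCompactSupport k ∧ ‖h - k‖ ≤ ε := by
  have h1 := h.zero_at_infty'.eventually (Metric.ball_mem_nhds 0 hε)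
  obtain ⟨K, hK, hKh⟩ := Filter.mem_cocompact.1 h1
  obtain ⟨φ, hφ1, -, hφ2, hφ3⟩ := exists_continuous_one_zero_of_isCompact hK
    (isClosed_empty (X := X)) (Set.disjoint_empty K)
  let k : C(X, ℂ) := ⟨fun x => (φ x : ℂ) * h x,
    (Complex.continuous_ofReal.comp φ.continuous).mul (map_continuous h)⟩
  have hk : HasCompactSupport k := by
    refine (hφ2.comp_left (g := fun a : ℝ => (a : ℂ)) Complex.ofReal_zero).mul_right
  refine ⟨⟨k, hk.is_zero_at_infty⟩, hk, ?_⟩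
  rw [← ZeroAtInftyContinuousMap.norm_toBCF_eq_norm,
    BoundedContinuousFunction.norm_le hε.le]
  intro x
  change ‖h x - (φ x : ℂ) * h x‖ ≤ ε
  have h2 : h x - (φ x : ℂ) * h x = ((1 - φ x : ℝ) : ℂ) * h x := by push_cast; ring
  rw [h2, norm_mul, Complex.norm_real, Real.norm_eq_abs, abs_of_nonneg (by linarith [(hφ3 x).2])]
  by_cases hx : x ∈ K
  · rw [hφ1 hx]
    simpa using hε.le
  · have h3 : dist (h x) 0 < ε := hKh hx
    rw [dist_zero_right] at h3
    calc (1 - φ x) * ‖h x‖ ≤ 1 * ‖h x‖ := by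
          gcongr
          linarith [(hφ3 x).1]
      _ ≤ ε := by rw [one_mul]; exact h3.le

lemma locallyCompactSpace_unitSpace [T2Space G] [LocallyCompactSpace G] :
    LocallyCompactSpace (UnitSpace G) :=
  (isClosed_unitSpace (G := G)).isClosedEmbedding_subtypeVal.locallyCompactSpace

/-! ### The inclusion of `C₀(G⁽⁰⁾)` and the expectation `P`. -/

section Inclusion

variable [T2Space G] [LocallyCompactSpace G]

/-- A function vanishing at infinity need not define a `C_c` section, so it is approximated by
compactly supported ones, `diagonal` being contractive. -/
lemma diagonal_mem (hG : IsEtale G) (h : C₀(UnitSpace G, ℂ)) :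
    t.diagonal h ∈ t.reducedCStarAlgebra := by
  have := locallyCompactSpace_unitSpace (G := G)
  rw [mem_reducedCStarAlgebra hG, Metric.mem_closure_iff]
  intro ε hε
  obtain ⟨k, hk, hhk⟩ := h.exists_hasCompactSupport_norm_sub_le (half_pos hε)
  refine ⟨t.diagonal k, ⟨_, isCcSection_unitKernel hG (map_continuous k) hk,
    hasKernel_diagonal k⟩, ?_⟩
  rw [dist_eq_norm, ← diagonal_sub]
  exact ((norm_diagonal_le _).trans hhk).trans_lt (half_lt_self hε)

variable (t) in
/-- The inclusion of `C₀(G⁽⁰⁾)` into the reduced C⋆-algebra. -/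
def inclusion (hG : IsEtale G) : C₀(UnitSpace G, ℂ) →⋆ₙₐ[ℂ] t.CStarRed where
  toFun h := ⟨t.diagonal h, diagonal_mem hG h⟩
  map_smul' c h := Subtype.ext (diagonal_smul h c)
  map_zero' := Subtype.ext (by
    have h := diagonal_sub (t := t) (0 : C₀(UnitSpace G, ℂ)) 0
    rwa [sub_self, sub_self] at h)
  map_add' h k := Subtype.ext (diagonal_add h k)
  map_mul' h k := Subtype.ext (diagonal_mul h k)
  map_star' h := Subtype.ext (diagonal_star h)

lemma toOp_inclusion (hG : IsEtale G) (h : C₀(UnitSpace G, ℂ)) :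
    (t.inclusion hG h).toOp = t.diagonal h := rfl

lemma isUnitSpaceInclusion_inclusion (hG : IsEtale G) : IsUnitSpaceInclusion (t.inclusion hG) :=
  ⟨fun h z x => by
    rw [toSection_of_hasKernel (a := t.inclusion hG h) (hasKernel_diagonal h), unitKernel_i],
  fun h σ hσ => by
    rw [toSection_of_hasKernel (a := t.inclusion hG h) (hasKernel_diagonal h),
      unitKernel_of_ne _ hσ]⟩

lemma restrict_star_mul_self (hG : IsEtale G) (a : t.CStarRed) (x : UnitSpace G) :
    restrict (star a * a) x =
      ((‖a.toOp.at x (H.delta x (t.i (1, x)) (source_i_one x))‖ ^ 2 : ℝ) : ℂ) := by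
  rw [restrict_eq_coeff hG, Op.coeff, ← H.inner_delta _ (source_i_one x), CStarRed.toOp_mul,
    Op.at_mul, CStarRed.toOp_star, Op.at_star, ContinuousLinearMap.adjoint_inner_right,
    inner_self_eq_norm_sq_to_K]
  norm_cast

/-- `P(a⋆a) = 0` kills every vector `π_x(a) ε_x`. These vectors are the restrictions of the section
of `a` to the source fibres, and the section determines `a`. -/
lemma isFaithful_expectation (hG : IsEtale G) : IsFaithful (t.expectation hG) := by
  intro a ha
  have h1 : ∀ x, a.toOp.at x (H.delta x (t.i (1, x)) (source_i_one x)) = 0 := by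
    intro x
    have h2 := restrict_star_mul_self hG a x
    rw [← expectation_apply hG, ha, ZeroAtInftyContinuousMap.zero_apply] at h2
    have h3 : ‖a.toOp.at x (H.delta x (t.i (1, x)) (source_i_one x))‖ ^ 2 = 0 := by
      exact_mod_cast h2.symm
    rwa [sq_eq_zero_iff, norm_eq_zero] at h3
  have h4 : toSection a = 0 := by
    funext σ
    rw [toSection_eq_coeff, Op.coeff, h1, H.ev_zero]
    rfl
  have h5 := hasKernel_toSection hG a
  rw [h4] at h5
  exact CStarRed.ext_toOp (h5.unique .zero)

lemma exists_star_mul_self_eq (hG : IsEtale G) (a : t.CStarRed) :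
    ∃ b, t.expectation hG (star a * a) = star b * b := by
  let n : UnitSpace G → ℝ := fun x =>
    ‖a.toOp.at x (H.delta x (t.i (1, x)) (source_i_one x))‖
  -- The witness `b` is the pointwise square root of `P(a⋆a)`. This expression for it supplies
  -- continuity and vanishing at infinity, which are not visible on `x ↦ ‖π_x(a) ε_x‖`.
  have hn : n = fun x => Real.sqrt ‖restrict (star a * a) x‖ := by
    funext x
    rw [restrict_star_mul_self hG, Complex.norm_real, Real.norm_of_nonneg (by positivity),
      Real.sqrt_sq (norm_nonneg _)]
  have hc : Continuous n := by
    rw [hn]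
    exact Real.continuous_sqrt.comp (continuous_restrict hG _).norm
  have ht : Filter.Tendsto n (Filter.cocompact _) (nhds 0) := by
    rw [hn]
    have h1 := (Real.continuous_sqrt.tendsto _).comp (tendsto_restrict hG (star a * a)).norm
    rw [norm_zero, Real.sqrt_zero] at h1
    exact h1
  refine ⟨⟨⟨fun x => (n x : ℂ), Complex.continuous_ofReal.comp hc⟩, ?_⟩, ?_⟩
  · have h1 := (Complex.continuous_ofReal.tendsto _).comp ht
    rw [Complex.ofReal_zero] at h1
    exact h1
  · refine ZeroAtInftyContinuousMap.ext fun x => ?_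
    rw [expectation_apply, restrict_star_mul_self hG]
    change _ = conj (n x : ℂ) * (n x : ℂ)
    rw [Complex.conj_ofReal, ← Complex.ofReal_mul, ← sq]

lemma isConditionalExpectation_expectation (hG : IsEtale G) :
    IsConditionalExpectation (t.inclusion hG) (t.expectation hG) where
  map_incl b := ZeroAtInftyContinuousMap.ext fun x => by
    have h := (isUnitSpaceInclusion_inclusion (t := t) hG).1 b 1 x
    rw [Circle.coe_one, map_one, mul_one] at h
    exact h
  norm_le a := by
    rw [← ZeroAtInftyContinuousMap.norm_toBCF_eq_norm,
      BoundedContinuousFunction.norm_le (norm_nonneg a)]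
    exact norm_restrict_le hG a
  map_star_mul_self := exists_star_mul_self_eq hG
  map_mul_left b a := ZeroAtInftyContinuousMap.ext fun x => by
    rw [ZeroAtInftyContinuousMap.mul_apply, expectation_apply, expectation_apply,
      restrict_eq_coeff hG, restrict_eq_coeff hG, CStarRed.toOp_mul, toOp_inclusion,
      diagonal_mul_coeff _ _ _ _ (source_i_one x), rangeMap_q_i]
  map_mul_right a b := ZeroAtInftyContinuousMap.ext fun x => by
    rw [ZeroAtInftyContinuousMap.mul_apply, expectation_apply, expectation_apply,
      restrict_eq_coeff hG, restrict_eq_coeff hG, CStarRed.toOp_mul, toOp_inclusion,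
      mul_diagonal_coeff, rangeMap_q_i]

/-! ### Uniqueness of the expectation in the essentially principal case. -/

section Uniqueness

variable {hG : IsEtale G} {Q : t.CStarRed →ₗ[ℂ] C₀(UnitSpace G, ℂ)}
  (hQ : IsConditionalExpectation (t.inclusion hG) Q)
include hQ

/-- The condition `h0` says that `h a h = 0`. The bimodule property then gives `h(x) Q(a)(x) h(x) =
0`. -/
lemma apply_eq_zero_of_mul_mul {a : t.CStarRed} {f : E → ℂ} (hf : a.toOp.HasKernel f)
    (h : C₀(UnitSpace G, ℂ)) {x : UnitSpace G} (hx : h x ≠ 0)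
    (h0 : ∀ σ, f σ ≠ 0 → h (rangeMap (t.q σ)) * h (sourceMap (t.q σ)) = 0) : Q a x = 0 := by
  have h1 : t.inclusion hG h * (a * t.inclusion hG h) = 0 := by
    refine CStarRed.ext_toOp (Op.ext_coeff fun y τ hτ σ hσ => ?_)
    have hst := hσ.trans hτ.symm
    have hc : s (t.q σ) = r (inv (t.q τ)) := by rw [r_inv, hst]
    rw [CStarRed.toOp_mul, CStarRed.toOp_mul, toOp_inclusion, diagonal_mul_coeff _ _ _ _ hσ,
      mul_diagonal_coeff, hf y τ hτ σ hσ, CStarRed.toOp_zero, Op.HasKernel.zero y τ hτ σ hσ]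
    by_cases h2 : f (mul σ (inv τ)) = 0
    · rw [h2]; simp
    · have h3 := h0 _ h2
      have hr : rangeMap (t.q (mul σ (inv τ))) = rangeMap (t.q σ) := by
        apply Subtype.ext
        change r _ = r _
        rw [t.q_mul_inv hst, r_mul _ _ hc]
      have hs : sourceMap (t.q (mul σ (inv τ))) = rangeMap (t.q τ) := by
        apply Subtype.ext
        change s _ = r _
        rw [t.q_mul_inv hst, s_mul _ _ hc, s_inv]
      rw [hr, hs] at h3
      rw [Pi.zero_apply]
      linear_combination (f (mul σ (inv τ))) * h3
  have h2 := hQ.map_mul_left h (a * t.inclusion hG h)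
  rw [h1, map_zero, hQ.map_mul_right] at h2
  have h3 := DFunLike.congr_fun h2 x
  rw [ZeroAtInftyContinuousMap.zero_apply, ZeroAtInftyContinuousMap.mul_apply,
    ZeroAtInftyContinuousMap.mul_apply] at h3
  have h4 := (mul_eq_zero.1 h3.symm).resolve_left hx
  exact (mul_eq_zero.1 h4).resolve_right hx

omit [LocallyCompactSpace G] hQ in
lemma exists_bump [LocallyCompactSpace (UnitSpace G)] {x : UnitSpace G} {F : Set (UnitSpace G)}
    (hF : IsClosed F) (hx : x ∉ F) : ∃ h : C₀(UnitSpace G, ℂ), h x ≠ 0 ∧ ∀ y ∈ F, h y = 0 := by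
  obtain ⟨φ, h1, h2, h3, -⟩ := exists_continuous_one_zero_of_isCompact
    (isCompact_singleton (x := x)) hF (Set.disjoint_singleton_left.2 hx)
  let k : C(UnitSpace G, ℂ) := ⟨fun y => (φ y : ℂ), Complex.continuous_ofReal.comp φ.continuous⟩
  have hk : HasCompactSupport k :=
    h3.comp_left (g := fun a : ℝ => (a : ℂ)) Complex.ofReal_zero
  refine ⟨⟨k, hk.is_zero_at_infty⟩, ?_, fun y hy => ?_⟩
  · change (φ x : ℂ) ≠ 0
    rw [h1 rfl]
    simp
  · change (φ y : ℂ) = 0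
    rw [h2 hy]
    simp

/-- Over an essentially principal groupoid, a conditional expectation vanishes on the sections
supported over a bisection without units. -/
lemma apply_eq_zero_of_isCcOn (hess : IsEssentiallyPrincipal G) {a : t.CStarRed} {f : E → ℂ}
    (ha : a.toOp.HasKernel f) {U : Set G} (hU : IsBisection U) (hne : ∀ γ ∈ U, r γ ≠ γ)
    (hf : t.IsCcOn U f) : Q a = 0 := by
  have := locallyCompactSpace_unitSpace (G := G)
  by_contra hQa
  have hex : ∃ x, Q a x ≠ 0 := by
    by_contra! h
    exact hQa (ZeroAtInftyContinuousMap.ext h)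
  obtain ⟨x₀, hx₀⟩ := hex
  obtain ⟨-, -, K, hK, hKU, h0⟩ := hf
  let O : Set (UnitSpace G) := {x | Q a x ≠ 0}
  have hO : IsOpen O := isOpen_ne.preimage (map_continuous (Q a))
  -- A bump at a unit outside `s(K)` multiplies `a` to zero on the right. In particular the unit
  -- `x₀` is the source of an arrow of `U`.
  have hOK : O ⊆ sourceMap '' K := by
    intro x hx
    by_contra hxK
    obtain ⟨h, h1, h2⟩ := exists_bump (hK.image continuous_sourceMap).isClosed hxK
    refine hx (apply_eq_zero_of_mul_mul hQ ha h h1 fun σ hσ => ?_)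
    rw [h2 (sourceMap (t.q σ)), mul_zero]
    refine ⟨_, ?_, rfl⟩
    by_contra h3
    exact hσ (h0 σ h3)
  have hW : IsOpen (U ∩ sourceMap ⁻¹' O) := hU.isOpen.inter (hO.preimage continuous_sourceMap)
  -- Otherwise this open set would consist of isotropy, hence of units by essential principality.
  -- But it contains an arrow of `K ⊆ U` with source `x₀`, and `U` has no units.
  have hγ : ∃ γ ∈ U ∩ sourceMap ⁻¹' O, r γ ≠ s γ := by
    by_contra! h
    have h1 : U ∩ sourceMap ⁻¹' O ⊆ interior {γ : G | r γ = s γ} := interior_maximal h hW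
    rw [hess] at h1
    obtain ⟨γ, hγK, rfl⟩ := hOK hx₀
    exact hne γ (hKU hγK) (h1 ⟨hKU hγK, hx₀⟩)
  obtain ⟨γ, ⟨hγU, hγO⟩, hrs⟩ := hγ
  obtain ⟨A, B, hA, hB, hrA, hsB, hAB⟩ := t2_separation hrs
  let N : Set G := U ∩ r ⁻¹' A
  have hN : IsOpen N := hU.isOpen.inter (hA.preimage continuous_r)
  -- If the source of an arrow of `U` lies in this set, injectivity of `s` on `U` puts the arrow in
  -- `N`. Its range is then in `A`, away from `B`, so a function `h` supported here cannot be
  -- nonzero at both its source and its range.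
  have hV : IsOpen (Subtype.val ⁻¹' B ∩ sourceMap '' N : Set (UnitSpace G)) :=
    (hB.preimage continuous_subtype_val).inter (hG.isOpenMap_sourceMap N hN)
  have hxV : sourceMap γ ∉ (Subtype.val ⁻¹' B ∩ sourceMap '' N : Set (UnitSpace G))ᶜ :=
    fun h => h ⟨hsB, γ, ⟨hγU, hrA⟩, rfl⟩
  obtain ⟨h, h1, h2⟩ := exists_bump hV.isClosed_compl hxV
  refine hγO (apply_eq_zero_of_mul_mul hQ ha h h1 fun σ hσ => ?_)
  have hσU : t.q σ ∈ U := by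
    by_contra h3
    exact hσ (h0 σ fun h4 => h3 (hKU h4))
  by_cases h3 : sourceMap (t.q σ) ∈ (Subtype.val ⁻¹' B ∩ sourceMap '' N : Set (UnitSpace G))
  · obtain ⟨-, γ', ⟨h4, h5⟩, h6⟩ := h3
    have h7 : γ' = t.q σ := hU.injOn_s h4 hσU (congrArg Subtype.val h6)
    rw [h7] at h5
    rw [h2 (rangeMap (t.q σ)), zero_mul]
    exact fun h8 => Set.disjoint_left.1 hAB h5 h8.1
  · rw [h2 _ h3, mul_zero]

theorem eq_expectation (hess : IsEssentiallyPrincipal G) : Q = t.expectation hG := by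
  have hP := isConditionalExpectation_expectation (t := t) hG
  have hpiece : ∀ (a : t.CStarRed) (U : Set G) (f : E → ℂ), IsBisection U →
      ((∀ γ ∈ U, r γ = γ) ∨ ∀ γ ∈ U, r γ ≠ γ) → t.IsCcOn U f → a.toOp.HasKernel f →
      Q a = t.expectation hG a := by
    rintro a U f hU (h | h) hf ha
    -- A section living over units is the image of its own restriction, where `Q` has no freedom.
    · have h1 : a = t.inclusion hG (t.expectation hG a) := by
        refine CStarRed.ext_toOp ((ha.unique ?_))
        have h2 : f = t.unitKernel (t.expectation hG a) := by
          rw [eq_unitKernel hf.2.1 fun σ hσ => hf.eq_zero fun h3 => hσ (h _ h3)]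
          congr 1
          funext x
          rw [expectation_apply, restrict_of_hasKernel ha]
        rw [h2]
        exact hasKernel_diagonal _
      conv_lhs => rw [h1]
      exact hQ.map_incl _
    -- The vanishing argument holds for any conditional expectation, so it serves for `Q` and for
    -- `P` alike.
    · rw [apply_eq_zero_of_isCcOn hQ hess ha hU h hf, apply_eq_zero_of_isCcOn hP hess ha hU h hf]
  have hreg : ∀ (a : t.CStarRed) (f : E → ℂ), t.IsCcSection f → a.toOp.HasKernel f →
      Q a = t.expectation hG a := by
    intro a f hf ha
    obtain ⟨n, U, F, rfl, hF⟩ := hf.exists_sum hG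
    choose T hT using fun i => (hF i).2.2.exists_hasKernel (hF i).1
    choose b hb using fun i => exists_toOp_eq (hF i).2.2.isCcSection (hT i)
    have hsum : ∀ I : Finset (Fin n), (∑ i ∈ I, b i).toOp = ∑ i ∈ I, T i := by
      intro I
      classical
      induction I using Finset.induction_on with
      | empty => rfl
      | insert i I hi ih =>
        rw [Finset.sum_insert hi, Finset.sum_insert hi, CStarRed.toOp_add, ih, hb]
    have h1 : a = ∑ i, b i := by
      refine CStarRed.ext_toOp (ha.unique ?_)
      rw [hsum]
      exact Op.HasKernel.sum _ fun i _ => hT i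
    rw [h1, map_sum, map_sum]
    refine Finset.sum_congr rfl fun i _ => ?_
    exact hpiece (b i) (U i) (F i) (hF i).1 (hF i).2.1 (hF i).2.2 (by rw [hb]; exact hT i)
  refine LinearMap.ext fun a => ?_
  rw [← sub_eq_zero, ← norm_le_zero_iff]
  refine le_of_forall_pos_le_add fun ε hε => ?_
  obtain ⟨b, hab, f, hf, hb⟩ := a.exists_approx hG (half_pos hε)
  -- `Q` and `P` agree on the approximant `b`, and each moves `a - b` by less than `ε / 2` because
  -- it is contractive.
  have h1 : Q a - t.expectation hG a = Q (a - b) - t.expectation hG (a - b) := by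
    rw [map_sub, map_sub, hreg b f hf hb]
    abel
  rw [h1, zero_add]
  refine (norm_sub_le _ _).trans ?_
  have h2 := hQ.norm_le (a - b)
  have h3 := hP.norm_le (a - b)
  linarith

end Uniqueness

end Inclusion

end Twist

end TwistedGroupoid

end

theorem mainTheorem3 {G : Type*} {E : Type*}
    [TopologicalSpace G] [TwistedGroupoid.TopGroupoid G]
    [TopologicalSpace E] [TwistedGroupoid.TopGroupoid E]
    [T2Space G] [LocallyCompactSpace G] [SecondCountableTopology G]
    (hG : TwistedGroupoid.IsEtale G) (t : TwistedGroupoid.Twist G E) :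
    ∃ (ι : C₀(TwistedGroupoid.UnitSpace G, ℂ) →⋆ₙₐ[ℂ] t.CStarRed)
      (P : t.CStarRed →ₗ[ℂ] C₀(TwistedGroupoid.UnitSpace G, ℂ)),
      TwistedGroupoid.Twist.IsUnitSpaceInclusion ι ∧
      (∀ a x, P a x = TwistedGroupoid.Twist.restrict a x) ∧
      (∀ f, t.IsCcSection f → ∃ a : t.CStarRed,
        t.IsRegularRep f a.toOp ∧ ∀ x, P a x = f (t.i (1, x))) ∧
      TwistedGroupoid.IsConditionalExpectation ι P ∧
      TwistedGroupoid.IsFaithful P ∧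
      (TwistedGroupoid.IsEssentiallyPrincipal G →
        ∀ Q : t.CStarRed →ₗ[ℂ] C₀(TwistedGroupoid.UnitSpace G, ℂ),
          TwistedGroupoid.IsConditionalExpectation ι Q → Q = P) := by
  refine ⟨t.inclusion hG, t.expectation hG,
    TwistedGroupoid.Twist.isUnitSpaceInclusion_inclusion hG, fun _ _ => rfl, fun f hf => ?_,
    TwistedGroupoid.Twist.isConditionalExpectation_expectation hG,
    TwistedGroupoid.Twist.isFaithful_expectation hG,
    fun hess Q hQ => TwistedGroupoid.Twist.eq_expectation hQ hess⟩
  obtain ⟨T, hT⟩ := hf.exists_hasKernel hG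
  obtain ⟨a, rfl⟩ := TwistedGroupoid.Twist.exists_toOp_eq hf hT
  exact ⟨a, hT.isRegularRep, TwistedGroupoid.Twist.restrict_of_hasKernel hT⟩
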